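/- Let $\mathfrak{g}$ be a finite-dimensional complex simple Lie algebra with Cartan subalgebra $\mathfrak{h}$, simple roots $\alpha_1,\dots,\alpha_r$ and half-sum of positive roots $\rho$. Let $(\cdot,\cdot)$ be the bilinear form on $\mathfrak{h}^*$ induced by the Killing form, normalized so that $(\alpha,\alpha)=2$ for every short root $\alpha$. Put $d_i=(\alpha_i,\alpha_i)/2$ and define $a_{ij}$ by $(\alpha_i,\alpha_j)=d_i a_{ij}$. Let $q$ be a real number with $q\ne 0,\pm 1$, and put $q_i=q^{d_i}$. Let $U_q(\mathfrak{g})$ be the complex algebra generated by $E_i,F_i,K_i^{\pm1}$ ($1\le i\le r$) with relations $K_iK_i^{-1}=K_i^{-1}K_i=1$, $K_iK_j=K_jK_i$, $K_iE_jK_i^{-1}=q_i^{a_{ij}}E_j$, $K_iF_jK_i^{-1}=q_i^{-a_{ij}}F_j$, $E_iF_j-F_jE_i=\delta_{ij}\frac{K_i-K_i^{-1}}{q_i-q_i^{-1}}$ and the quantum Serre relations. It is a Hopf $*$-algebra with $\Delta(K_i)=K_i\otimes K_i$, $\Delta(E_i)=E_i\otimes K_i+1\otimes E_i$, $\Delta(F_i)=F_i\otimes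 1+K_i^{-1}\otimes F_i$, $S(K_i)=K_i^{-1}$, $S(E_i)=-E_iK_i^{-1}$, $S(F_i)=-K_iF_i$, $\varepsilon(K_i)=1$, $\varepsilon(E_i)=\varepsilon(F_i)=0$, $K_i^*=K_i$, $E_i^*=K_iF_i$, $F_i^*=E_iK_i^{-1}$. For $\lambda=\sum_i n_i\alpha_i$ with $n_i\in\mathbb{Z}$ write $K_\lambda=K_1^{n_1}\cdots K_r^{n_r}$. Let $\mathbb{C}_q[G]$ be the span in $U_q(\mathfrak{g})^*$ of the matrix coefficients of the finite-dimensional (type 1) representations of $U_q(\mathfrak{g})$, with $(\phi\psi)(X)=(\phi\otimes\psi)(\Delta(X))$, unit the counit of $U_q(\mathfrak{g})$, $\varepsilon(\phi)=\phi(1)$, $\phi^*(X)=\overline{\phi(S(X)^*)}$ and $(X\triangleright\phi)(Y)=\phi(YX)$. For each $a\in\{1,\dots,r\}$ let $\eta_a:\mathbb{C}_q[G]^{\otimes 3}\to\mathbb{C}$ be the linear functional $$\eta_a(a_0\otimes a_1\otimes a_2)=\varepsilon(a_0)\,\varepsilon(F_a\triangleright a_1)\,\varepsilon(E_a\triangleright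 a_2).$$ Let $V(\Lambda)$ be a finite-dimensional irreducible representation of $U_q(\mathfrak{g})$ with dominant integral highest weight $\Lambda$, with an inner product for which it is a $*$-representation. Let $\{v_i\}$ be an orthonormal basis of weight vectors, $v_i$ of weight $\lambda_i$ (so $K_jv_i=q^{(\alpha_j,\lambda_i)}v_i$). Write $Xv_j=\sum_i\pi(X)^i_j v_i$, let $u^i_j\in\mathbb{C}_q[G]$ be the matrix coefficients $u^i_j(X)=\pi(X)^i_j$, and let $\mathsf{N}^n_m$ be the matrix over $\mathbb{C}_q[G]$ with entries $(\mathsf{N}^n_m)^i_j=u^i_m\,(u^j_n)^*$. **Theorem.** Let $\mathsf{Q}=\sum_{m,n}c^m_n\,\mathsf{N}^n_m$ with $c^m_n\in\mathbb{C}$ be a projection, that is $\mathsf{Q}^2=\mathsf{Q}$, and suppose that $c^m_n=0$ whenever $\lambda_m\neq\lambda_n$. Let $$C(\mathsf{Q})=\mathrm{Tr}\big(\pi(K_{2\rho})(2\mathsf{Q}-\mathrm{Id})\otimes\mathsf{Q}\otimes\mathsf{Q}\big)=\sum_{i,k,l}\big(\pi(K_{2\rho})(2\mathsf{Q}-\mathrm{Id})\big)^i_k\otimes\mathsf{Q}^k_l\otimes\mathsf{Q}^l_i\in\mathbb{C}_q[G]^{\otimes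 3}.$$ Then for every $a\in\{1,\dots,r\}$ $$\eta_a(C(\mathsf{Q}))=\sum_i c^i_i\,q^{-(\alpha_a-2\rho,\lambda_i)}\,\big[d_a^{-1}(\alpha_a,\lambda_i)\big]_{q_a},\qquad [x]_p=\frac{p^x-p^{-x}}{p-p^{-1}}.$$ -/

import Mathlib

noncomputable section

namespace QFlag

/-- The symmetric Gaussian binomial `[n]_v! / ([k]_v! [n - k]_v!)`, where
`[m]_v = (v ^ m - v ^ (-m)) / (v - v⁻¹)`, defined by its Pascal rule
`[n + 1, k + 1] = v ^ (-(k + 1)) [n, k + 1] + v ^ (n - k) [n, k]`. -/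
def qBinom (v : ℂ) : ℕ → ℕ → ℂ
  | _, 0 => 1
  | 0, _ + 1 => 0
  | n + 1, k + 1 => v ^ (-((k : ℤ) + 1)) * qBinom v n (k + 1) + v ^ ((n : ℤ) - k) * qBinom v n k

@[simp] lemma qBinom_zero_right (v : ℂ) (n : ℕ) : qBinom v n 0 = 1 := by
  cases n <;> rfl

lemma qBinom_succ_succ (v : ℂ) (n k : ℕ) : qBinom v (n + 1) (k + 1) =
    v ^ (-((k : ℤ) + 1)) * qBinom v n (k + 1) + v ^ ((n : ℤ) - k) * qBinom v n k := rfl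

lemma qBinom_of_lt (v : ℂ) (n k : ℕ) (h : n < k) : qBinom v n k = 0 := by
  induction n generalizing k with
  | zero => cases k with
    | zero => omega
    | succ k => rfl
  | succ n ih => cases k with
    | zero => omega
    | succ k => rw [qBinom_succ_succ, ih _ (by omega), ih _ (by omega)]; simp

lemma qBinom_self (v : ℂ) (n : ℕ) : qBinom v n n = 1 := by
  induction n with
  | zero => rfl
  | succ n ih => rw [qBinom_succ_succ, ih, qBinom_of_lt _ _ _ (by omega)]; simp

lemma qBinom_aux {v : ℂ} (hv : v ≠ 0) (n k : ℕ) :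
    (v ^ ((k : ℤ) + 1) - v ^ (-((k : ℤ) + 1))) * qBinom v n (k + 1)
      = (v ^ ((n : ℤ) - k) - v ^ (-((n : ℤ) - k))) * qBinom v n k := by
  induction n generalizing k with
  | zero => cases k with
    | zero => simp [qBinom]
    | succ k => simp [qBinom]
  | succ n ih =>
    have key : ∀ j : ℕ, v ^ (-((j : ℤ) + 1)) * (v ^ ((n : ℤ) - j) - v ^ (-((n : ℤ) - j)))
        + v ^ ((n : ℤ) - j) * (v ^ ((j : ℤ) + 1) - v ^ (-((j : ℤ) + 1)))
        = v ^ ((n : ℤ) + 1) - v ^ (-((n : ℤ) + 1)) := by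
      intro j
      simp only [mul_sub, ← zpow_add₀ hv]
      ring_nf
    have h1 : (v ^ ((k : ℤ) + 1) - v ^ (-((k : ℤ) + 1))) * qBinom v (n + 1) (k + 1)
        = (v ^ ((n : ℤ) + 1) - v ^ (-((n : ℤ) + 1))) * qBinom v n k := by
      rw [qBinom_succ_succ, ← key k]
      linear_combination (v ^ (-((k : ℤ) + 1))) * ih k
    rw [h1]
    cases k with
    | zero => simp
    | succ j =>
      rw [qBinom_succ_succ, ← key j]
      push_cast
      have e : ((n : ℤ) + 1 - (j + 1)) = n - j := by ring
      rw [e]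
      linear_combination (v ^ ((n : ℤ) - j)) * ih j

lemma qBinom_succ_succ' {v : ℂ} (hv : v ≠ 0) (n k : ℕ) : qBinom v (n + 1) (k + 1) =
    v ^ ((k : ℤ) + 1) * qBinom v n (k + 1) + v ^ (-((n : ℤ) - k)) * qBinom v n k := by
  rw [qBinom_succ_succ]
  linear_combination -qBinom_aux hv n k

lemma qBinom_symm {v : ℂ} (hv : v ≠ 0) (n k : ℕ) (h : k ≤ n) :
    qBinom v n (n - k) = qBinom v n k := by
  induction n generalizing k with
  | zero => simp at h; subst h; rfl
  | succ n ih => cases k with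
    | zero => simp [qBinom_self]
    | succ k =>
      rcases Nat.lt_or_ge k n with hk | hk
      · obtain ⟨m, rfl⟩ : ∃ m, n = k + 1 + m := ⟨n - (k + 1), by omega⟩
        have e1 : k + 1 + m + 1 - (k + 1) = m + 1 := by omega
        rw [e1, qBinom_succ_succ' hv, qBinom_succ_succ]
        have i1 := ih k (by omega)
        have i2 := ih (k + 1) (by omega)
        rw [show k + 1 + m - k = m + 1 by omega] at i1
        rw [show k + 1 + m - (k + 1) = m by omega] at i2
        rw [i1, i2]
        push_cast
        ring_nf
      · have : k = n := by omega
        subst this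
        simp [qBinom_self]

lemma conj_qBinom (v : ℂ) (n k : ℕ) :
    (starRingEnd ℂ) (qBinom v n k) = qBinom ((starRingEnd ℂ) v) n k := by
  induction n generalizing k with
  | zero => cases k <;> simp [qBinom]
  | succ n ih => cases k with
    | zero => simp
    | succ k => simp [qBinom_succ_succ, ih, map_zpow₀]

/-- The quantum Serre expression `∑_k (-1) ^ k [r, k]_v x ^ (r - k) y x ^ k`. -/
def qSerre {A : Type*} [Ring A] [Algebra ℂ A] (v : ℂ) (r : ℕ) (x y : A) : A :=
  ∑ k ∈ Finset.range (r + 1), ((-1) ^ k * qBinom v r k) • (x ^ (r - k) * y * x ^ k)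

section Serre
variable {A : Type*} [Ring A] [Algebra ℂ A]

lemma map_qSerre {B : Type*} [Ring B] [Algebra ℂ B] (f : A →ₐ[ℂ] B) (v : ℂ) (r : ℕ) (x y : A) :
    f (qSerre v r x y) = qSerre v r (f x) (f y) := by
  simp [qSerre, map_sum]

open MulOpposite in
lemma qSerre_op {v : ℂ} (hv : v ≠ 0) (r : ℕ) (x y : A) :
    qSerre v r (op x) (op y) = ((-1 : ℂ) ^ r) • op (qSerre v r x y) := by
  unfold qSerre
  rw [← Finset.sum_range_reflect, Finset.op_sum, Finset.smul_sum]
  refine Finset.sum_congr rfl fun k hk => ?_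
  have hk' : k ≤ r := by simpa [Nat.lt_succ_iff] using hk
  have e1 : r + 1 - 1 - k = r - k := by omega
  have e2 : r - (r - k) = k := by omega
  rw [e1, e2, qBinom_symm hv r k hk', op_smul, smul_smul]
  have e3 : (-1 : ℂ) ^ (r - k) = (-1) ^ r * (-1) ^ k := by
    obtain ⟨m, rfl⟩ := Nat.exists_eq_add_of_le hk'
    rw [show k + m - k = m by omega, pow_add]
    have : ((-1 : ℂ) ^ k) * (-1) ^ k = 1 := by rw [← mul_pow]; simp
    linear_combination -(-1 : ℂ) ^ m * this
  rw [e3]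
  simp [op_mul, op_pow, mul_assoc]

/-- Iterated twisted commutators of `x` with `y`; they compute `qSerre`. -/
def serreT (v : ℂ) (c : ℤ) (x y : A) : ℕ → A
  | 0 => y
  | n + 1 => x * serreT v c x y n - v ^ (c + 2 * n) • (serreT v c x y n * x)

lemma serreT_eq_sum {v : ℂ} (hv : v ≠ 0) (c : ℤ) (x y : A) (n : ℕ) :
    serreT v c x y n = ∑ k ∈ Finset.range (n + 1),
      ((-1) ^ k * (v ^ ((c + n - 1) * k) * qBinom v n k)) • (x ^ (n - k) * y * x ^ k) := by
  induction n with
  | zero => simp [serreT]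
  | succ n ih =>
    rw [serreT, ih, Finset.mul_sum, Finset.sum_mul, Finset.smul_sum]
    rw [Finset.sum_range_succ' _ (n + 1), Finset.sum_range_succ' _ n]
    have h2 : ∀ k ∈ Finset.range (n + 1),
        ((-1 : ℂ) ^ (k + 1) * (v ^ ((c + (n + 1 : ℕ) - 1) * (k + 1 : ℕ)) * qBinom v (n + 1) (k + 1)))
          • (x ^ (n + 1 - (k + 1)) * y * x ^ (k + 1))
        = ((-1 : ℂ) ^ (k + 1) * (v ^ ((c + n - 1) * (k + 1 : ℕ)) * qBinom v n (k + 1)))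
          • (x ^ (n + 1 - (k + 1)) * y * x ^ (k + 1))
          - v ^ (c + 2 * n) • (((-1) ^ k * (v ^ ((c + n - 1) * k) * qBinom v n k))
            • (x ^ (n - k) * y * x ^ k) * x) := by
      intro k _
      rw [smul_mul_assoc, mul_assoc (x ^ (n - k) * y), ← pow_succ, smul_smul,
        show n + 1 - (k + 1) = n - k by omega, ← sub_smul]
      congr 1
      rw [qBinom_succ_succ]
      have a1 : v ^ ((c + (n + 1 : ℕ) - 1) * (k + 1 : ℕ)) * v ^ (-((k : ℤ) + 1))
          = v ^ ((c + n - 1) * (k + 1 : ℕ)) := by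
        rw [← zpow_add₀ hv]; congr 1; push_cast; ring
      have a2 : v ^ ((c + (n + 1 : ℕ) - 1) * (k + 1 : ℕ)) * v ^ ((n : ℤ) - k)
          = v ^ (c + 2 * n) * v ^ ((c + n - 1) * k) := by
        rw [← zpow_add₀ hv, ← zpow_add₀ hv]; congr 1; push_cast; ring
      rw [← a1]
      linear_combination ((-1) ^ (k + 1) * qBinom v n k) * a2
    rw [Finset.sum_congr rfl h2, Finset.sum_sub_distrib]
    rw [Finset.sum_range_succ (fun k => ((-1 : ℂ) ^ (k + 1) *
      (v ^ ((c + n - 1) * (k + 1 : ℕ)) * qBinom v n (k + 1)))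
          • (x ^ (n + 1 - (k + 1)) * y * x ^ (k + 1))) n, qBinom_of_lt v n (n + 1) (by omega)]
    have h3 : ∀ k ∈ Finset.range n, x * (((-1 : ℂ) ^ (k + 1) *
        (v ^ ((c + n - 1) * (k + 1 : ℕ)) * qBinom v n (k + 1)))
          • (x ^ (n - (k + 1)) * y * x ^ (k + 1))) = ((-1 : ℂ) ^ (k + 1) *
        (v ^ ((c + n - 1) * (k + 1 : ℕ)) * qBinom v n (k + 1)))
          • (x ^ (n + 1 - (k + 1)) * y * x ^ (k + 1)) := by
      intro k hk
      have hk' : k < n := by simpa using hk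
      rw [mul_smul_comm, ← mul_assoc x, ← mul_assoc x, ← pow_succ',
        show n - (k + 1) + 1 = n + 1 - (k + 1) by omega]
    rw [Finset.sum_congr rfl h3]
    simp only [qBinom_zero_right, mul_zero, zero_smul, add_zero, Nat.cast_zero, zpow_zero,
      pow_zero, mul_one, one_smul, Nat.sub_zero, ← mul_assoc, ← pow_succ']
    abel

lemma qSerre_eq {v : ℂ} (hv : v ≠ 0) (r : ℕ) (x y : A) :
    qSerre v r x y = serreT v (1 - r) x y r := by
  rw [serreT_eq_sum hv, qSerre]
  refine Finset.sum_congr rfl fun k _ => ?_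
  rw [show ((1 - r + r - 1 : ℤ)) = 0 by ring]
  simp

lemma serreT_add (v : ℂ) (c : ℤ) (x y z : A) (n : ℕ) :
    serreT v c x (y + z) n = serreT v c x y n + serreT v c x z n := by
  induction n with
  | zero => rfl
  | succ n ih => simp only [serreT, ih, mul_add, add_mul, smul_add]; abel

lemma qSerre_smul (v : ℂ) (r : ℕ) (s t : ℂ) (x y : A) :
    qSerre v r (s • x) (t • y) = (s ^ r * t) • qSerre v r x y := by
  unfold qSerre
  rw [Finset.smul_sum]
  refine Finset.sum_congr rfl fun k hk => ?_
  have hk' : k ≤ r := by simpa [Nat.lt_succ_iff] using hk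
  simp only [smul_pow, smul_mul_assoc, mul_smul_comm, smul_smul]
  congr 1
  obtain ⟨m, rfl⟩ := Nat.exists_eq_add_of_le hk'
  rw [show k + m - k = m by omega]
  ring

lemma qSerre_twist {v : ℂ} (hv : v ≠ 0) (r : ℕ) {x y k l : A} {s t : ℂ}
    (hkx : k * x = s • (x * k)) (hky : k * y = t • (y * k)) (hlx : l * x = t • (x * l))
    (hkl : k * l = l * k) :
    ∃ e : ℂ, qSerre v r (x * k) (y * l) = e • (qSerre v r x y * k ^ r * l) := by
  rw [qSerre_eq hv, qSerre_eq hv]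
  generalize (1 - r : ℤ) = c
  have hk : ∀ n, k * serreT v c x y n = (t * s ^ n) • (serreT v c x y n * k) := by
    intro n
    induction n with
    | zero => simpa [serreT] using hky
    | succ n ih =>
      have h1 : k * (x * serreT v c x y n) = (t * s ^ (n + 1)) • (x * serreT v c x y n * k) := by
        rw [← mul_assoc, hkx, smul_mul_assoc, mul_assoc, ih, mul_smul_comm, smul_smul, mul_assoc]
        congr 1; ring
      have h2 : k * (serreT v c x y n * x) = (t * s ^ (n + 1)) • (serreT v c x y n * x * k) := by
        rw [← mul_assoc, ih, smul_mul_assoc, mul_assoc, hkx, mul_smul_comm, smul_smul, mul_assoc,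
          pow_succ]
        simp only [mul_assoc]
      rw [serreT, mul_sub, mul_smul_comm, h1, h2, sub_mul, smul_sub, smul_mul_assoc,
        smul_comm (v ^ _)]
  have hkn : ∀ n : ℕ, k ^ n * x = s ^ n • (x * k ^ n) := by
    intro n
    induction n with
    | zero => simp
    | succ n ih =>
      rw [pow_succ, mul_assoc, hkx, mul_smul_comm, ← mul_assoc, ih, smul_mul_assoc, smul_smul,
        mul_assoc, pow_succ']
  have hkl' : ∀ n : ℕ, l * k ^ n = k ^ n * l := fun n =>
    ((show Commute k l from hkl).pow_left n).symm
  have main : ∀ n : ℕ, ∃ e : ℂ,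
      serreT v c (x * k) (y * l) n = e • (serreT v c x y n * k ^ n * l) := by
    intro n
    induction n with
    | zero => exact ⟨1, by simp [serreT]⟩
    | succ n ih =>
      obtain ⟨e, he⟩ := ih
      refine ⟨e * (t * s ^ n), ?_⟩
      have h1 : x * k * (serreT v c x y n * k ^ n * l)
          = (t * s ^ n) • (x * serreT v c x y n * k ^ (n + 1) * l) := by
        calc x * k * (serreT v c x y n * k ^ n * l)
            = x * (k * serreT v c x y n) * k ^ n * l := by simp only [mul_assoc]
          _ = _ := by
            rw [hk, mul_smul_comm, smul_mul_assoc, smul_mul_assoc, pow_succ']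
            simp only [mul_assoc]
      have h2 : serreT v c x y n * k ^ n * l * (x * k)
          = (t * s ^ n) • (serreT v c x y n * x * k ^ (n + 1) * l) := by
        calc serreT v c x y n * k ^ n * l * (x * k)
            = serreT v c x y n * (k ^ n * (l * x)) * k := by simp only [mul_assoc]
          _ = t • (serreT v c x y n * (k ^ n * x) * (l * k)) := by
            rw [hlx]; simp only [mul_smul_comm, smul_mul_assoc, mul_assoc]
          _ = _ := by
            rw [hkn, ← hkl, pow_succ]
            simp only [mul_smul_comm, smul_mul_assoc, mul_assoc, smul_smul]
      rw [serreT, he, mul_smul_comm, smul_mul_assoc, h1, h2, serreT, sub_mul, sub_mul,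
        smul_sub, smul_mul_assoc, smul_mul_assoc, smul_smul, smul_smul, smul_smul, smul_smul]
      congr 2
      ring
  exact main r

/-- Half of the additivity of `qSerre`. -/
lemma serreT_add_left {v : ℂ} (hv : v ≠ 0) (r : ℕ) {x₁ x₂ y : A}
    (hx : x₁ * x₂ = v ^ 2 • (x₂ * x₁)) (hy : y * x₂ = v ^ (1 - r : ℤ) • (x₂ * y)) :
    serreT v (1 - r) (x₁ + x₂) y r = serreT v (1 - r) x₁ y r := by
  set a : ℤ := 1 - r with ha
  have hw : ∀ m : ℕ, serreT v a x₁ y m * x₂ = v ^ (a + 2 * m) • (x₂ * serreT v a x₁ y m) := by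
    intro m
    induction m with
    | zero => simpa [serreT] using hy
    | succ m ih =>
      have e : v ^ (a + 2 * (m + 1 : ℕ)) = v ^ 2 * v ^ (a + 2 * m) := by
        rw [← zpow_natCast, ← zpow_add₀ hv]; congr 1; push_cast; ring
      have h1 : x₁ * serreT v a x₁ y m * x₂
          = (v ^ 2 * v ^ (a + 2 * m)) • (x₂ * (x₁ * serreT v a x₁ y m)) := by
        rw [mul_assoc, ih, mul_smul_comm, ← mul_assoc, hx, smul_mul_assoc, smul_smul, mul_assoc,
          mul_comm (v ^ 2)]
      have h2 : serreT v a x₁ y m * x₁ * x₂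
          = (v ^ 2 * v ^ (a + 2 * m)) • (x₂ * (serreT v a x₁ y m * x₁)) := by
        rw [mul_assoc, hx, mul_smul_comm, ← mul_assoc, ih, smul_mul_assoc, smul_smul, mul_assoc]
      rw [serreT, sub_mul, smul_mul_assoc, h1, h2, e, mul_sub, smul_sub, mul_smul_comm,
        smul_comm (v ^ (a + 2 * (m : ℤ)))]
  have hx' : ∀ p : ℕ, x₁ * x₂ ^ p = (v ^ 2) ^ p • (x₂ ^ p * x₁) := by
    intro p
    induction p with
    | zero => simp
    | succ p ih =>
      rw [pow_succ, ← mul_assoc, ih, smul_mul_assoc, mul_assoc, hx, mul_smul_comm, smul_smul,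
        ← mul_assoc]
      congr 1
  let g : ℕ → ℕ → ℂ := fun n p => v ^ ((p : ℤ) * (n - p)) * qBinom v n p *
    ∏ l ∈ Finset.range p, (1 - v ^ (2 * a + 2 * ((n : ℤ) - 1 - l)))
  have g0 : ∀ n, g n 0 = 1 := fun n => by simp [g]
  have gtop : ∀ n, g n (n + 1) = 0 := fun n => by simp [g, qBinom_of_lt]
  have grec : ∀ n p, g (n + 1) (p + 1) = v ^ (2 * ((p : ℤ) + 1)) * g n (p + 1)
      + (1 - v ^ (2 * a + 2 * n + 2 * (n - p))) * g n p := by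
    intro n p
    simp only [g]
    rw [Finset.prod_range_succ', Finset.prod_range_succ]
    have e0 : ∀ l : ℕ, ((n + 1 : ℕ) : ℤ) - 1 - ((l + 1 : ℕ) : ℤ) = (n : ℤ) - 1 - l := by
      intro l; push_cast; ring
    simp only [e0]
    have key : v ^ (((p + 1 : ℕ) : ℤ) * ((n + 1 : ℕ) - (p + 1 : ℕ))) * qBinom v (n + 1) (p + 1) *
          (1 - v ^ (2 * a + 2 * (((n + 1 : ℕ) : ℤ) - 1 - (0 : ℕ))))
        = v ^ (2 * ((p : ℤ) + 1)) * (v ^ (((p + 1 : ℕ) : ℤ) * (n - (p + 1 : ℕ)))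
            * qBinom v n (p + 1) * (1 - v ^ (2 * a + 2 * ((n : ℤ) - 1 - p))))
          + (1 - v ^ (2 * a + 2 * n + 2 * (n - p))) * (v ^ ((p : ℤ) * (n - p)) * qBinom v n p) := by
      have c1 : v ^ (((p + 1 : ℕ) : ℤ) * ((n + 1 : ℕ) - (p + 1 : ℕ))) * v ^ ((p : ℤ) + 1)
          = v ^ (2 * ((p : ℤ) + 1)) * v ^ (((p + 1 : ℕ) : ℤ) * (n - (p + 1 : ℕ))) := by
        rw [← zpow_add₀ hv, ← zpow_add₀ hv]; congr 1; push_cast; ring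
      have c2 : v ^ (((p + 1 : ℕ) : ℤ) * ((n + 1 : ℕ) - (p + 1 : ℕ))) * v ^ (-((n : ℤ) - p))
          = v ^ ((p : ℤ) * (n - p)) := by
        rw [← zpow_add₀ hv]; congr 1; push_cast; ring
      have c3 : v ^ (((p + 1 : ℕ) : ℤ) * ((n + 1 : ℕ) - (p + 1 : ℕ)))
            * v ^ (2 * a + 2 * (((n + 1 : ℕ) : ℤ) - 1 - (0 : ℕ))) * v ^ (-((p : ℤ) + 1))
          = v ^ (2 * ((p : ℤ) + 1)) * v ^ (((p + 1 : ℕ) : ℤ) * (n - (p + 1 : ℕ)))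
            * v ^ (2 * a + 2 * ((n : ℤ) - 1 - p)) := by
        simp only [← zpow_add₀ hv]; congr 1; push_cast; ring
      have c4 : v ^ (((p + 1 : ℕ) : ℤ) * ((n + 1 : ℕ) - (p + 1 : ℕ)))
            * v ^ (2 * a + 2 * (((n + 1 : ℕ) : ℤ) - 1 - (0 : ℕ))) * v ^ ((n : ℤ) - p)
          = v ^ (2 * a + 2 * n + 2 * (n - p)) * v ^ ((p : ℤ) * (n - p)) := by
        simp only [← zpow_add₀ hv]; congr 1; push_cast; ring
      have h1 := qBinom_succ_succ v n p
      have h2 := qBinom_succ_succ' hv n p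
      linear_combination v ^ (((p + 1 : ℕ) : ℤ) * ((n + 1 : ℕ) - (p + 1 : ℕ))) * h2
        - v ^ (((p + 1 : ℕ) : ℤ) * ((n + 1 : ℕ) - (p + 1 : ℕ)))
            * v ^ (2 * a + 2 * (((n + 1 : ℕ) : ℤ) - 1 - (0 : ℕ))) * h1
        + qBinom v n (p + 1) * c1 + qBinom v n p * c2 - qBinom v n (p + 1) * c3
        - qBinom v n p * c4
    linear_combination (∏ l ∈ Finset.range p, (1 - v ^ (2 * a + 2 * ((n : ℤ) - 1 - l)))) * key
  have hg : ∀ n : ℕ, serreT v a (x₁ + x₂) y n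
        = ∑ p ∈ Finset.range (n + 1), g n p • (x₂ ^ p * serreT v a x₁ y (n - p)) := by
    intro n
    induction n with
    | zero => simp [serreT, g0]
    | succ n ih =>
      have step : ∀ p ∈ Finset.range (n + 1),
          (x₁ + x₂) * (g n p • (x₂ ^ p * serreT v a x₁ y (n - p)))
            - v ^ (a + 2 * n) • ((g n p • (x₂ ^ p * serreT v a x₁ y (n - p))) * (x₁ + x₂))
          = (v ^ (2 * (p : ℤ)) * g n p) • (x₂ ^ p * serreT v a x₁ y (n + 1 - p))
            + ((1 - v ^ (2 * a + 2 * n + 2 * (n - p))) * g n p)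
              • (x₂ ^ (p + 1) * serreT v a x₁ y (n + 1 - (p + 1))) := by
        intro p hp
        have hp' : p ≤ n := by simpa [Nat.lt_succ_iff] using hp
        obtain ⟨m, rfl⟩ := Nat.exists_eq_add_of_le hp'
        rw [show p + m - p = m by omega, show p + m + 1 - p = m + 1 by omega,
          show p + m + 1 - (p + 1) = m by omega]
        have t1 : x₁ * (x₂ ^ p * serreT v a x₁ y m)
            = v ^ (2 * (p : ℤ)) • (x₂ ^ p * (x₁ * serreT v a x₁ y m)) := by
          rw [← mul_assoc, hx', smul_mul_assoc, mul_assoc, zpow_mul, zpow_natCast]; norm_cast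
        have t2 : x₂ ^ p * serreT v a x₁ y m * x₂
            = v ^ (a + 2 * m) • (x₂ ^ (p + 1) * serreT v a x₁ y m) := by
          rw [mul_assoc, hw, mul_smul_comm, ← mul_assoc, ← pow_succ]
        have t3 : x₂ * (x₂ ^ p * serreT v a x₁ y m) = x₂ ^ (p + 1) * serreT v a x₁ y m := by
          rw [← mul_assoc, ← pow_succ']
        have e1 : v ^ (a + 2 * ((p + m : ℕ) : ℤ)) * v ^ (a + 2 * (m : ℤ))
            = v ^ (2 * a + 2 * ((p + m : ℕ) : ℤ) + 2 * (((p + m : ℕ) : ℤ) - p)) := by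
          rw [← zpow_add₀ hv]; congr 1; push_cast; ring
        have e2 : v ^ (a + 2 * ((p + m : ℕ) : ℤ)) = v ^ (2 * (p : ℤ)) * v ^ (a + 2 * (m : ℤ)) := by
          rw [← zpow_add₀ hv]; congr 1; push_cast; ring
        rw [← e1, mul_smul_comm, smul_mul_assoc, add_mul, mul_add, t1, t2, t3, serreT, mul_sub,
          mul_smul_comm, mul_assoc (x₂ ^ p), e2]
        module
      rw [serreT, ih, Finset.mul_sum, Finset.sum_mul, Finset.smul_sum, ← Finset.sum_sub_distrib,
        Finset.sum_congr rfl step, Finset.sum_add_distrib, Finset.sum_range_succ' _ (n + 1),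
        Finset.sum_range_succ' _ n]
      have last : ∑ p ∈ Finset.range n, (v ^ (2 * ((p + 1 : ℕ) : ℤ)) * g n (p + 1)) •
            (x₂ ^ (p + 1) * serreT v a x₁ y (n + 1 - (p + 1)))
          = ∑ p ∈ Finset.range (n + 1), (v ^ (2 * ((p + 1 : ℕ) : ℤ)) * g n (p + 1)) •
            (x₂ ^ (p + 1) * serreT v a x₁ y (n + 1 - (p + 1))) := by
        rw [Finset.sum_range_succ _ n, gtop]; simp
      rw [last, add_right_comm, ← Finset.sum_add_distrib]
      congr 1
      · refine Finset.sum_congr rfl fun p _ => ?_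
        rw [grec, add_smul]; norm_cast
      · simp [g0]
  rw [hg, Finset.sum_range_succ', Finset.sum_eq_zero]
  · simp [g0]
  · intro p _
    have : g r (p + 1) = 0 := by
      simp only [g]
      rw [Finset.prod_range_succ', ha]
      rw [show (2 * (1 - r : ℤ) + 2 * ((r : ℤ) - 1 - (0 : ℕ))) = 0 by push_cast; ring]
      simp
    rw [this, zero_smul]

open MulOpposite in
lemma qSerre_add {v : ℂ} (hv : v ≠ 0) (r : ℕ) {x₁ x₂ y₁ y₂ : A}
    (hx : x₁ * x₂ = v ^ 2 • (x₂ * x₁)) (h₁ : y₁ * x₂ = v ^ (1 - r : ℤ) • (x₂ * y₁))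
    (h₂ : x₁ * y₂ = v ^ (1 - r : ℤ) • (y₂ * x₁))
    (s₁ : qSerre v r x₁ y₁ = 0) (s₂ : qSerre v r x₂ y₂ = 0) :
    qSerre v r (x₁ + x₂) (y₁ + y₂) = 0 := by
  have a₁ : qSerre v r (x₁ + x₂) y₁ = 0 := by
    rw [qSerre_eq hv, serreT_add_left hv r hx h₁, ← qSerre_eq hv, s₁]
  have a₂ : qSerre v r (x₁ + x₂) y₂ = 0 := by
    have h : qSerre v r (op x₂ + op x₁) (op y₂) = 0 := by
      rw [qSerre_eq hv, serreT_add_left hv r, ← qSerre_eq hv, qSerre_op hv, s₂]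
      · simp
      · rw [← op_mul, ← op_mul, hx, op_smul]
      · rw [← op_mul, ← op_mul, h₂, op_smul]
    rw [← op_add, qSerre_op hv] at h
    have h' := (smul_eq_zero_iff_right (pow_ne_zero r (by norm_num : (-1 : ℂ) ≠ 0))).mp h
    rw [add_comm]
    simpa using h'
  rw [qSerre_eq hv] at a₁ a₂ ⊢
  rw [serreT_add, a₁, a₂, add_zero]

end Serre


/-- A Cartan matrix `a` together with a symmetrizer `d`: `d_i a_ij = d_j a_ji`. -/
structure CartanDatum (I : Type*) where
  a : I → I → ℤ
  d : I → ℕ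
  symm : ∀ i j, (d i : ℤ) * a i j = d j * a j i
  diag : ∀ i, a i i = 2
  nonpos : ∀ i j, i ≠ j → a i j ≤ 0

section Uq
variable {I : Type*} (D : CartanDatum I) (q : ℝˣ)

/-- `q_i = q ^ d_i`. -/
def CartanDatum.qi (i : I) : ℂ := ((q : ℝ) : ℂ) ^ D.d i

/-- The natural number `1 - a_ij` (for `i ≠ j`, where `a_ij ≤ 0`). -/
def CartanDatum.serreDeg (i j : I) : ℕ := (1 - D.a i j).toNat

/-- The generators `E_i, F_i, K_i, K_i⁻¹`. -/
inductive Gen (I : Type*)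
  | E (i : I)
  | F (i : I)
  | K (i : I)
  | Kinv (i : I)

open FreeAlgebra in
/-- The defining relations of `U_q(𝔤)`, including the quantum Serre relations. -/
inductive Rel : FreeAlgebra ℂ (Gen I) → FreeAlgebra ℂ (Gen I) → Prop
  | K_mul_Kinv (i : I) : Rel (ι ℂ (.K i) * ι ℂ (.Kinv i)) 1
  | Kinv_mul_K (i : I) : Rel (ι ℂ (.Kinv i) * ι ℂ (.K i)) 1
  | K_comm (i j : I) : Rel (ι ℂ (.K i) * ι ℂ (.K j)) (ι ℂ (.K j) * ι ℂ (.K i))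
  | K_E (i j : I) : Rel (ι ℂ (.K i) * ι ℂ (.E j) * ι ℂ (.Kinv i))
      (D.qi q i ^ D.a i j • ι ℂ (.E j))
  | K_F (i j : I) : Rel (ι ℂ (.K i) * ι ℂ (.F j) * ι ℂ (.Kinv i))
      (D.qi q i ^ (-D.a i j) • ι ℂ (.F j))
  | E_F_same (i : I) : Rel (ι ℂ (.E i) * ι ℂ (.F i) - ι ℂ (.F i) * ι ℂ (.E i))
      ((D.qi q i - (D.qi q i)⁻¹)⁻¹ • (ι ℂ (.K i) - ι ℂ (.Kinv i)))
  | E_F_ne (i j : I) (h : i ≠ j) :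
      Rel (ι ℂ (.E i) * ι ℂ (.F j) - ι ℂ (.F j) * ι ℂ (.E i)) 0
  | serre_E (i j : I) (h : i ≠ j) :
      Rel (qSerre (D.qi q i) (D.serreDeg i j) (ι ℂ (.E i)) (ι ℂ (.E j))) 0
  | serre_F (i j : I) (h : i ≠ j) :
      Rel (qSerre (D.qi q i) (D.serreDeg i j) (ι ℂ (.F i)) (ι ℂ (.F j))) 0

/-- The quantized universal enveloping algebra, by generators and relations. -/
def Uq : Type _ := RingQuot (Rel D q)

instance : Ring (Uq D q) := inferInstanceAs (Ring (RingQuot (Rel D q)))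
instance : Algebra ℂ (Uq D q) := inferInstanceAs (Algebra ℂ (RingQuot (Rel D q)))

namespace Uq

/-- Quotient map. -/
def mk : FreeAlgebra ℂ (Gen I) →ₐ[ℂ] Uq D q := RingQuot.mkAlgHom ℂ (Rel D q)

/-- The generator `E_i`. -/
def E (i : I) : Uq D q := mk D q (FreeAlgebra.ι ℂ (.E i))
/-- The generator `F_i`. -/
def F (i : I) : Uq D q := mk D q (FreeAlgebra.ι ℂ (.F i))
/-- The generator `K_i`. -/
def K (i : I) : Uq D q := mk D q (FreeAlgebra.ι ℂ (.K i))
/-- The generator `K_i⁻¹`. -/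
def Kinv (i : I) : Uq D q := mk D q (FreeAlgebra.ι ℂ (.Kinv i))

/-- Elements of an algebra `B` that satisfy the defining relations. -/
structure Relations {B : Type*} [Ring B] [Algebra ℂ B] (e f k k' : I → B) : Prop where
  k_k' : ∀ i, k i * k' i = 1
  k'_k : ∀ i, k' i * k i = 1
  k_comm : ∀ i j, k i * k j = k j * k i
  k_e : ∀ i j, k i * e j = D.qi q i ^ D.a i j • (e j * k i)
  k_f : ∀ i j, k i * f j = D.qi q i ^ (-D.a i j) • (f j * k i)
  e_f_same : ∀ i, e i * f i - f i * e i = (D.qi q i - (D.qi q i)⁻¹)⁻¹ • (k i - k' i)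
  e_f_ne : ∀ i j, i ≠ j → e i * f j = f j * e i
  serre_e : ∀ i j, i ≠ j → qSerre (D.qi q i) (D.serreDeg i j) (e i) (e j) = 0
  serre_f : ∀ i j, i ≠ j → qSerre (D.qi q i) (D.serreDeg i j) (f i) (f j) = 0

variable {D q}
variable {B : Type*} [Ring B] [Algebra ℂ B]

/-- The image of the generators. -/
def genMap (e f k k' : I → B) : Gen I → B
  | .E i => e i
  | .F i => f i
  | .K i => k i
  | .Kinv i => k' i

lemma lift_aux {e f k k' : I → B} (h : Relations D q e f k k') :
    ∀ ⦃x y⦄, Rel D q x y → FreeAlgebra.lift ℂ (genMap e f k k') x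
      = FreeAlgebra.lift ℂ (genMap e f k k') y := by
  intro x y hxy
  induction hxy with
  | K_mul_Kinv i => simpa [genMap] using h.k_k' i
  | Kinv_mul_K i => simpa [genMap] using h.k'_k i
  | K_comm i j => simpa [genMap] using h.k_comm i j
  | K_E i j => simp [genMap, h.k_e i j, mul_assoc (e j), h.k_k' i]
  | K_F i j =>
    have := h.k_f i j
    simp only [zpow_neg] at this
    simp [genMap, this, mul_assoc (f j), h.k_k' i]
  | E_F_same i => simpa [genMap] using h.e_f_same i
  | E_F_ne i j hij => simpa [genMap, sub_eq_zero] using h.e_f_ne i j hij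
  | serre_E i j hij => simpa [map_qSerre, genMap] using h.serre_e i j hij
  | serre_F i j hij => simpa [map_qSerre, genMap] using h.serre_f i j hij

/-- The algebra homomorphism given on generators by `e, f, k, k'`. -/
def lift (e f k k' : I → B) (h : Relations D q e f k k') : Uq D q →ₐ[ℂ] B :=
  RingQuot.liftAlgHom ℂ ⟨FreeAlgebra.lift ℂ (genMap e f k k'), lift_aux h⟩

section
variable {e f k k' : I → B} (h : Relations D q e f k k') (i : I)

lemma lift_mk (x : FreeAlgebra ℂ (Gen I)) :
    lift e f k k' h (mk D q x) = FreeAlgebra.lift ℂ (genMap e f k k') x :=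
  RingQuot.liftAlgHom_mkAlgHom_apply ℂ _ _ _

@[simp] lemma lift_E : lift e f k k' h (E D q i) = e i := by simp [E, lift_mk, genMap]
@[simp] lemma lift_F : lift e f k k' h (F D q i) = f i := by simp [F, lift_mk, genMap]
@[simp] lemma lift_K : lift e f k k' h (K D q i) = k i := by simp [K, lift_mk, genMap]
@[simp] lemma lift_Kinv : lift e f k k' h (Kinv D q i) = k' i := by simp [Kinv, lift_mk, genMap]
end

lemma algHom_ext {φ ψ : Uq D q →ₐ[ℂ] B} (hE : ∀ i, φ (E D q i) = ψ (E D q i))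
    (hF : ∀ i, φ (F D q i) = ψ (F D q i)) (hK : ∀ i, φ (K D q i) = ψ (K D q i))
    (hK' : ∀ i, φ (Kinv D q i) = ψ (Kinv D q i)) : φ = ψ := by
  apply RingQuot.ringQuot_ext'
  apply FreeAlgebra.hom_ext
  funext g
  cases g with
  | E i => exact hE i
  | F i => exact hF i
  | K i => exact hK i
  | Kinv i => exact hK' i

lemma mk_rel {x y : FreeAlgebra ℂ (Gen I)} (h : Rel D q x y) : mk D q x = mk D q y :=
  RingQuot.mkAlgHom_rel ℂ h

lemma relations : Relations D q (E D q) (F D q) (K D q) (Kinv D q) where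
  k_k' i := by simpa [E, F, K, Kinv] using mk_rel (Rel.K_mul_Kinv (D := D) (q := q) i)
  k'_k i := by simpa [E, F, K, Kinv] using mk_rel (Rel.Kinv_mul_K (D := D) (q := q) i)
  k_comm i j := by simpa [E, F, K, Kinv] using mk_rel (Rel.K_comm (D := D) (q := q) i j)
  k_e i j := by
    have h1 := mk_rel (Rel.K_E (D := D) (q := q) i j)
    have h2 : Kinv D q i * K D q i = 1 := by
      simpa [K, Kinv] using mk_rel (Rel.Kinv_mul_K (D := D) (q := q) i)
    simp only [map_mul, map_smul] at h1
    change K D q i * E D q j * Kinv D q i = _ • E D q j at h1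
    rw [← smul_mul_assoc, ← h1, mul_assoc _ _ (K D q i), h2, mul_one]
  k_f i j := by
    have h1 := mk_rel (Rel.K_F (D := D) (q := q) i j)
    have h2 : Kinv D q i * K D q i = 1 := by
      simpa [K, Kinv] using mk_rel (Rel.Kinv_mul_K (D := D) (q := q) i)
    simp only [map_mul, map_smul] at h1
    change K D q i * F D q j * Kinv D q i = _ • F D q j at h1
    rw [← smul_mul_assoc, ← h1, mul_assoc _ _ (K D q i), h2, mul_one]
  e_f_same i := by simpa [E, F, K, Kinv] using mk_rel (Rel.E_F_same (D := D) (q := q) i)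
  e_f_ne i j h := by
    have := mk_rel (Rel.E_F_ne (D := D) (q := q) i j h)
    simpa [sub_eq_zero, E, F] using this
  serre_e i j h := by simpa [map_qSerre, E, F] using mk_rel (Rel.serre_E (D := D) (q := q) i j h)
  serre_f i j h := by simpa [map_qSerre, E, F] using mk_rel (Rel.serre_F (D := D) (q := q) i j h)

variable (D q) in
lemma qi_ne_zero (i : I) : D.qi q i ≠ 0 := pow_ne_zero _ (by simp)

variable (D q) in
/-- The scalar `q_i ^ a_ij = q ^ (α_i, α_j)`. -/
def Q (i j : I) : ℂ := D.qi q i ^ D.a i j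

lemma Q_ne_zero (i j : I) : Q D q i j ≠ 0 := zpow_ne_zero _ (qi_ne_zero D q i)

lemma Q_symm (i j : I) : Q D q i j = Q D q j i := by
  simp only [Q, CartanDatum.qi, ← zpow_natCast, ← zpow_mul, D.symm i j]

lemma Q_self (i : I) : Q D q i i = D.qi q i ^ 2 := by
  rw [Q, D.diag]; norm_cast

lemma Q_serre {i j : I} (h : i ≠ j) : Q D q i j = D.qi q i ^ (1 - D.serreDeg i j : ℤ) := by
  have := D.nonpos i j h
  rw [Q, CartanDatum.serreDeg, Int.toNat_of_nonneg (by omega)]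
  congr 1; ring

lemma conj_qi (i : I) : (starRingEnd ℂ) (D.qi q i) = D.qi q i := by
  simp [CartanDatum.qi]

namespace Relations
variable {e f k k' : I → B} 

lemma ke (h : Relations D q e f k k') (i j : I) : k i * e j = Q D q i j • (e j * k i) := h.k_e i j

lemma kf (h : Relations D q e f k k') (i j : I) : k i * f j = (Q D q i j)⁻¹ • (f j * k i) := by
  rw [h.k_f, Q, zpow_neg]

lemma ek (h : Relations D q e f k k') (i j : I) : e j * k i = (Q D q i j)⁻¹ • (k i * e j) := by
  rw [h.ke, smul_smul, inv_mul_cancel₀ (Q_ne_zero i j), one_smul]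

lemma fk (h : Relations D q e f k k') (i j : I) : f j * k i = Q D q i j • (k i * f j) := by
  rw [h.kf, smul_smul, mul_inv_cancel₀ (Q_ne_zero i j), one_smul]

lemma k'e (h : Relations D q e f k k') (i j : I) : k' i * e j = (Q D q i j)⁻¹ • (e j * k' i) := by
  calc k' i * e j = k' i * (e j * k i) * k' i := by simp [mul_assoc, h.k_k']
    _ = _ := by
      rw [h.ek, mul_smul_comm, ← mul_assoc, h.k'_k, one_mul, smul_mul_assoc]

lemma k'f (h : Relations D q e f k k') (i j : I) : k' i * f j = Q D q i j • (f j * k' i) := by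
  calc k' i * f j = k' i * (f j * k i) * k' i := by simp [mul_assoc, h.k_k']
    _ = _ := by
      rw [h.fk, mul_smul_comm, ← mul_assoc, h.k'_k, one_mul, smul_mul_assoc]

lemma kk' (h : Relations D q e f k k') (i j : I) : k i * k' j = k' j * k i := by
  calc k i * k' j = k' j * (k j * k i) * k' j := by rw [← mul_assoc, h.k'_k, one_mul]
    _ = _ := by rw [h.k_comm j i]; simp [mul_assoc, h.k_k']

lemma k'k' (h : Relations D q e f k k') (i j : I) : k' i * k' j = k' j * k' i := by
  calc k' i * k' j = k' j * (k j * k' i) * k' j := by rw [← mul_assoc, h.k'_k, one_mul]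
    _ = _ := by rw [h.kk' j i]; simp [mul_assoc, h.k_k']

end Relations

lemma qSerre_twist' {v : ℂ} (hv : v ≠ 0) (r : ℕ) {x y k l : B} {s t : ℂ}
    (hkx : k * x = s • (x * k)) (hky : k * y = t • (y * k)) (hlx : l * x = t • (x * l))
    (hkl : k * l = l * k) (h0 : qSerre v r x y = 0) : qSerre v r (x * k) (y * l) = 0 := by
  obtain ⟨e, he⟩ := qSerre_twist hv r hkx hky hlx hkl
  rw [he, h0]; simp

open TensorProduct in
lemma qSerre_tmul {v : ℂ} (hv : v ≠ 0) (r : ℕ) {C : Type*} [Ring C] [Algebra ℂ C]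
    {x y : B} {k l : C} (hkl : k * l = l * k) (h0 : qSerre v r x y = 0) :
    qSerre v r (x ⊗ₜ[ℂ] k) (y ⊗ₜ[ℂ] l) = 0 := by
  have := qSerre_twist' hv r (x := x ⊗ₜ[ℂ] (1 : C)) (y := y ⊗ₜ[ℂ] (1 : C))
    (k := (1 : B) ⊗ₜ[ℂ] k) (l := (1 : B) ⊗ₜ[ℂ] l) (s := 1) (t := 1)
    (by simp) (by simp) (by simp) (by simp [hkl])
    (by
      have := map_qSerre (Algebra.TensorProduct.includeLeft (R := ℂ) (S := ℂ) (A := B) (B := C))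
        v r x y
      rw [h0, map_zero] at this
      simpa using this.symm)
  simpa using this

open TensorProduct in
lemma qSerre_tmul' {v : ℂ} (hv : v ≠ 0) (r : ℕ) {C : Type*} [Ring C] [Algebra ℂ C]
    {x y : B} {k l : C} (hkl : k * l = l * k) (h0 : qSerre v r x y = 0) :
    qSerre v r (k ⊗ₜ[ℂ] x) (l ⊗ₜ[ℂ] y) = 0 := by
  have := map_qSerre (Algebra.TensorProduct.comm ℂ B C).toAlgHom v r (x ⊗ₜ[ℂ] k) (y ⊗ₜ[ℂ] l)
  rw [qSerre_tmul hv r hkl h0, map_zero] at this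
  simpa using this.symm

open TensorProduct in
/-- The comultiplication on generators satisfies the defining relations. -/
lemma relations_comul : Relations D q
    (fun i => E D q i ⊗ₜ[ℂ] K D q i + 1 ⊗ₜ[ℂ] E D q i)
    (fun i => F D q i ⊗ₜ[ℂ] 1 + Kinv D q i ⊗ₜ[ℂ] F D q i)
    (fun i => K D q i ⊗ₜ[ℂ] K D q i)
    (fun i => Kinv D q i ⊗ₜ[ℂ] Kinv D q i) := by
  have h : Relations D q (E D q) (F D q) (K D q) (Kinv D q) := relations
  have hv := qi_ne_zero D q
  refine ⟨fun i => ?_, fun i => ?_, fun i j => ?_, fun i j => ?_, fun i j => ?_, fun i => ?_,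
    fun i j hij => ?_, fun i j hij => ?_, fun i j hij => ?_⟩
  · simp [h.k_k', Algebra.TensorProduct.one_def]
  · simp [h.k'_k, Algebra.TensorProduct.one_def]
  · simp [h.k_comm i j]
  · change _ = Q D q i j • _
    simp only [mul_add, add_mul, Algebra.TensorProduct.tmul_mul_tmul, h.ke, h.k_comm i j,
      mul_one, one_mul, smul_add, smul_tmul', tmul_smul]
  · rw [zpow_neg]
    change _ = (Q D q i j)⁻¹ • _
    simp only [mul_add, add_mul, Algebra.TensorProduct.tmul_mul_tmul, h.kf, h.kk' i j,
      mul_one, one_mul, smul_add, smul_tmul', tmul_smul]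
  · have e1 := h.e_f_same i
    set c := (D.qi q i - (D.qi q i)⁻¹)⁻¹
    have e2 : E D q i * F D q i = F D q i * E D q i + c • (K D q i - Kinv D q i) := by
      rw [← e1]; abel
    have e3 : (E D q i * Kinv D q i) ⊗ₜ[ℂ] (K D q i * F D q i)
        = (Kinv D q i * E D q i) ⊗ₜ[ℂ] (F D q i * K D q i) := by
      rw [h.k'e, h.kf, tmul_smul, smul_tmul']
    simp only [mul_add, add_mul, Algebra.TensorProduct.tmul_mul_tmul, mul_one, one_mul, e2, e3,
      add_tmul, tmul_add, tmul_smul, ← smul_tmul', tmul_sub, sub_tmul]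
    module
  · have e2 := h.e_f_ne i j hij
    have e3 : (E D q i * Kinv D q j) ⊗ₜ[ℂ] (K D q i * F D q j)
        = (Kinv D q j * E D q i) ⊗ₜ[ℂ] (F D q j * K D q i) := by
      rw [h.k'e, h.kf, tmul_smul, smul_tmul', Q_symm]
    simp only [mul_add, add_mul, Algebra.TensorProduct.tmul_mul_tmul, mul_one, one_mul, e2, e3]
    abel
  · apply qSerre_add (hv i)
    · simp only [Algebra.TensorProduct.tmul_mul_tmul, mul_one, one_mul, h.ke, Q_self, tmul_smul]
    · simp only [Algebra.TensorProduct.tmul_mul_tmul, mul_one, one_mul, h.ke, tmul_smul]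
      rw [Q_symm, Q_serre hij]
    · simp only [Algebra.TensorProduct.tmul_mul_tmul, mul_one, one_mul, h.ke, tmul_smul]
      rw [Q_serre hij]
    · exact qSerre_tmul (hv i) _ (h.k_comm i j) (h.serre_e i j hij)
    · exact qSerre_tmul' (hv i) _ rfl (h.serre_e i j hij)
  · rw [add_comm (F D q i ⊗ₜ[ℂ] 1), add_comm (F D q j ⊗ₜ[ℂ] 1)]
    apply qSerre_add (hv i)
    · simp only [Algebra.TensorProduct.tmul_mul_tmul, mul_one, one_mul, h.k'f, Q_self, smul_tmul']
    · simp only [Algebra.TensorProduct.tmul_mul_tmul, mul_one, one_mul, h.k'f, smul_tmul']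
      rw [Q_symm, Q_serre hij]
    · simp only [Algebra.TensorProduct.tmul_mul_tmul, mul_one, one_mul, h.k'f, smul_tmul']
      rw [Q_serre hij]
    · exact qSerre_tmul' (hv i) _ (h.k'k' i j) (h.serre_f i j hij)
    · exact qSerre_tmul (hv i) _ rfl (h.serre_f i j hij)

lemma relations_counit : Relations D q (fun _ => (0 : ℂ)) (fun _ => 0) (fun _ => 1)
    (fun _ => 1) := by
  have : ∀ (v : ℂ) r, qSerre v r (0 : ℂ) 0 = 0 := fun v r => by simp [qSerre]
  constructor <;> simp [this]

open TensorProduct in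
/-- The comultiplication: `Δ K_i = K_i ⊗ K_i`, `Δ E_i = E_i ⊗ K_i + 1 ⊗ E_i`,
`Δ F_i = F_i ⊗ 1 + K_i⁻¹ ⊗ F_i`. -/
def comul : Uq D q →ₐ[ℂ] Uq D q ⊗[ℂ] Uq D q := lift _ _ _ _ relations_comul

/-- The counit: `ε K_i = 1`, `ε E_i = ε F_i = 0`. -/
def counit : Uq D q →ₐ[ℂ] ℂ := lift _ _ _ _ relations_counit

open TensorProduct in
instance : Bialgebra ℂ (Uq D q) := Bialgebra.ofAlgHom comul counit
  (by
    apply algHom_ext <;> intro i <;>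
      simp [comul, tmul_add, add_tmul, Algebra.TensorProduct.one_def, add_assoc])
  (by apply algHom_ext <;> intro i <;> simp [comul, counit])
  (by apply algHom_ext <;> intro i <;> simp [comul, counit])

open MulOpposite in
lemma relations_antipode : Relations D q
    (fun i => op (-(E D q i * Kinv D q i))) (fun i => op (-(K D q i * F D q i)))
    (fun i => op (Kinv D q i)) (fun i => op (K D q i)) := by
  have h : Relations D q (E D q) (F D q) (K D q) (Kinv D q) := relations
  have hv := qi_ne_zero D q
  refine ⟨fun i => ?_, fun i => ?_, fun i j => ?_, fun i j => ?_, fun i j => ?_, fun i => ?_,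
    fun i j hij => ?_, fun i j hij => ?_, fun i j hij => ?_⟩
  · simp [← op_mul, h.k_k']
  · simp [← op_mul, h.k'_k]
  · simp [← op_mul, h.k'k' i j]
  · change _ = Q D q i j • _
    rw [← op_mul, ← op_mul, ← op_smul]
    congr 1
    rw [mul_neg, ← mul_assoc, h.k'e, neg_mul, smul_neg, smul_mul_assoc, smul_smul,
      mul_inv_cancel₀ (Q_ne_zero i j), one_smul, mul_assoc, mul_assoc, h.k'k']
  · rw [zpow_neg]
    change _ = (Q D q i j)⁻¹ • _
    rw [← op_mul, ← op_mul, ← op_smul]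
    congr 1
    rw [mul_neg, ← mul_assoc, ← h.kk', mul_assoc (K D q j), h.k'f, neg_mul, smul_neg,
      mul_smul_comm, smul_smul, inv_mul_cancel₀ (Q_ne_zero i j), one_smul, mul_assoc]
  · rw [← op_mul, ← op_mul, ← op_sub, ← op_sub, ← op_smul]
    congr 1
    have e1 : K D q i * F D q i * (E D q i * Kinv D q i) = F D q i * E D q i := by
      rw [← mul_assoc, mul_assoc (K D q i), ← mul_assoc (K D q i), h.kf, smul_mul_assoc, mul_assoc (F D q i),
        h.ke, mul_smul_comm, smul_smul, inv_mul_cancel₀ (Q_ne_zero i i), one_smul]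
      simp [mul_assoc, h.k_k']
    have e2 : E D q i * Kinv D q i * (K D q i * F D q i) = E D q i * F D q i := by
      rw [mul_assoc, ← mul_assoc (Kinv D q i), h.k'_k, one_mul]
    rw [neg_mul_neg, neg_mul_neg, e1, e2, ← neg_sub, h.e_f_same i, ← smul_neg, neg_sub]
  · rw [← op_mul, ← op_mul]
    congr 1
    rw [neg_mul_neg, neg_mul_neg]
    have e1 : K D q j * F D q j * (E D q i * Kinv D q i)
        = (Q D q i j * (Q D q j j)⁻¹) • (F D q j * E D q i * (K D q j * Kinv D q i)) := by
      rw [h.kf, smul_mul_assoc, mul_assoc, ← mul_assoc (K D q j), h.ke, Q_symm j i, smul_mul_assoc,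
        mul_smul_comm, smul_smul, mul_comm (Q D q i j)]
      simp only [mul_assoc]
    have e2 : E D q i * Kinv D q i * (K D q j * F D q j)
        = (Q D q i j * (Q D q j j)⁻¹) • (F D q j * E D q i * (K D q j * Kinv D q i)) := by
      rw [h.kf, mul_smul_comm, mul_assoc (E D q i), ← mul_assoc (Kinv D q i), h.k'f,
        smul_mul_assoc, mul_smul_comm, smul_smul, ← mul_assoc, ← mul_assoc, h.e_f_ne i j hij,
        mul_comm (Q D q i j), mul_assoc (F D q j * E D q i), h.kk' j i]
    rw [e1, e2]
  · have e1 : ∀ i, op (-(E D q i * Kinv D q i)) = (-Q D q i i) • (op (E D q i) * op (Kinv D q i)) := by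
      intro i
      rw [← op_mul, h.k'e, op_smul, smul_smul, op_neg, neg_mul, mul_inv_cancel₀ (Q_ne_zero i i)]
      simp
    simp only [e1]
    rw [qSerre_smul, qSerre_twist' (hv i) _ (s := Q D q i i) (t := Q D q i j), smul_zero]
    · rw [← op_mul, ← op_mul, ← op_smul, h.k'e, smul_smul, mul_inv_cancel₀ (Q_ne_zero _ _),
        one_smul]
    · rw [← op_mul, ← op_mul, ← op_smul, h.k'e, smul_smul, mul_inv_cancel₀ (Q_ne_zero _ _),
        one_smul]
    · rw [← op_mul, ← op_mul, ← op_smul, h.k'e, smul_smul, Q_symm i j,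
        mul_inv_cancel₀ (Q_ne_zero _ _), one_smul]
    · rw [← op_mul, ← op_mul, h.k'k']
    · rw [qSerre_op (hv i), h.serre_e i j hij]; simp
  · have e1 : ∀ i, op (-(K D q i * F D q i)) = (-1 : ℂ) • (op (F D q i) * op (K D q i)) := by
      intro i
      simp [← op_mul]
    simp only [e1]
    rw [qSerre_smul, qSerre_twist' (hv i) _ (s := Q D q i i) (t := Q D q i j), smul_zero]
    · rw [← op_mul, ← op_mul, ← op_smul, h.fk]
    · rw [← op_mul, ← op_mul, ← op_smul, h.fk]
    · rw [← op_mul, ← op_mul, ← op_smul, h.fk, Q_symm i j]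
    · rw [← op_mul, ← op_mul, h.k_comm]
    · rw [qSerre_op (hv i), h.serre_f i j hij]; simp

/-- The antipode as an algebra homomorphism to the opposite algebra: `S K_i = K_i⁻¹`,
`S E_i = - E_i K_i⁻¹`, `S F_i = - K_i F_i`. -/
def antipodeHom : Uq D q →ₐ[ℂ] (Uq D q)ᵐᵒᵖ := lift _ _ _ _ relations_antipode

/-- The antipode. -/
def antipode (X : Uq D q) : Uq D q := (antipodeHom X).unop

open MulOpposite in
lemma relations_star : Relations D q
    (fun i => op (K D q i * F D q i)) (fun i => op (E D q i * Kinv D q i))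
    (fun i => op (K D q i)) (fun i => op (Kinv D q i)) := by
  have h : Relations D q (E D q) (F D q) (K D q) (Kinv D q) := relations
  have hv := qi_ne_zero D q
  refine ⟨fun i => ?_, fun i => ?_, fun i j => ?_, fun i j => ?_, fun i j => ?_, fun i => ?_,
    fun i j hij => ?_, fun i j hij => ?_, fun i j hij => ?_⟩
  · simp [← op_mul, h.k'_k]
  · simp [← op_mul, h.k_k']
  · simp [← op_mul, h.k_comm i j]
  · change _ = Q D q i j • _
    rw [← op_mul, ← op_mul, ← op_smul]
    congr 1
    rw [mul_assoc, h.fk, mul_smul_comm, ← mul_assoc, ← mul_assoc, h.k_comm]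
  · rw [zpow_neg]
    change _ = (Q D q i j)⁻¹ • _
    rw [← op_mul, ← op_mul, ← op_smul]
    congr 1
    rw [mul_assoc, ← h.kk', ← mul_assoc, ← mul_assoc, h.ek, smul_mul_assoc]
  · rw [← op_mul, ← op_mul, ← op_sub, ← op_sub, ← op_smul]
    congr 1
    have e1 : K D q i * F D q i * (E D q i * Kinv D q i) = F D q i * E D q i := by
      rw [← mul_assoc, mul_assoc (K D q i), ← mul_assoc (K D q i), h.kf, smul_mul_assoc, mul_assoc (F D q i),
        h.ke, mul_smul_comm, smul_smul, inv_mul_cancel₀ (Q_ne_zero i i), one_smul]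
      simp [mul_assoc, h.k_k']
    have e2 : E D q i * Kinv D q i * (K D q i * F D q i) = E D q i * F D q i := by
      rw [mul_assoc, ← mul_assoc (Kinv D q i), h.k'_k, one_mul]
    rw [e1, e2, h.e_f_same i]
  · rw [← op_mul, ← op_mul]
    congr 1
    have e1 : K D q i * F D q i * (E D q j * Kinv D q j)
        = (Q D q i j * (Q D q i i)⁻¹) • (F D q i * E D q j * (K D q i * Kinv D q j)) := by
      rw [h.kf, smul_mul_assoc, mul_assoc, ← mul_assoc (K D q i), h.ke, smul_mul_assoc,
        mul_smul_comm, smul_smul, mul_comm (Q D q i j)]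
      simp only [mul_assoc]
    have e2 : E D q j * Kinv D q j * (K D q i * F D q i)
        = (Q D q i j * (Q D q i i)⁻¹) • (F D q i * E D q j * (K D q i * Kinv D q j)) := by
      rw [h.kf, mul_smul_comm, mul_assoc (E D q j), ← mul_assoc (Kinv D q j), h.k'f,
        smul_mul_assoc, mul_smul_comm, smul_smul, ← mul_assoc, ← mul_assoc, h.e_f_ne j i hij.symm,
        mul_comm (Q D q i j), mul_assoc (F D q i * E D q j), h.kk' i j, Q_symm i j]
    rw [e1, e2]
  · simp only [op_mul]
    rw [qSerre_twist' (hv i) _ (s := Q D q i i) (t := Q D q i j)]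
    · rw [← op_mul, ← op_mul, ← op_smul, h.fk]
    · rw [← op_mul, ← op_mul, ← op_smul, h.fk]
    · rw [← op_mul, ← op_mul, ← op_smul, h.fk, Q_symm i j]
    · rw [← op_mul, ← op_mul, h.k_comm]
    · rw [qSerre_op (hv i), h.serre_f i j hij]; simp
  · have e1 : ∀ i, op (E D q i * Kinv D q i) = (Q D q i i) • (op (E D q i) * op (Kinv D q i)) := by
      intro i
      rw [← op_mul, h.k'e, op_smul, smul_smul, mul_inv_cancel₀ (Q_ne_zero i i), one_smul]
    simp only [e1]
    rw [qSerre_smul, qSerre_twist' (hv i) _ (s := Q D q i i) (t := Q D q i j), smul_zero]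
    · rw [← op_mul, ← op_mul, ← op_smul, h.k'e, smul_smul, mul_inv_cancel₀ (Q_ne_zero _ _),
        one_smul]
    · rw [← op_mul, ← op_mul, ← op_smul, h.k'e, smul_smul, mul_inv_cancel₀ (Q_ne_zero _ _),
        one_smul]
    · rw [← op_mul, ← op_mul, ← op_smul, h.k'e, smul_smul, Q_symm i j,
        mul_inv_cancel₀ (Q_ne_zero _ _), one_smul]
    · rw [← op_mul, ← op_mul, h.k'k']
    · rw [qSerre_op (hv i), h.serre_e i j hij]; simp

/-- The complex conjugate of a `ℂ`-algebra: same ring, scalars act through conjugation. -/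
def Conj (A : Type*) : Type _ := A

instance (A : Type*) [Ring A] : Ring (Conj A) := inferInstanceAs (Ring A)

instance (A : Type*) [Ring A] [Algebra ℂ A] : Algebra ℂ (Conj A) :=
  RingHom.toAlgebra' ((algebraMap ℂ A).comp (starRingEnd ℂ) : ℂ →+* A)
    (fun _ x => Algebra.commutes (R := ℂ) (A := A) _ x)

/-- The identity map, as a ring isomorphism onto the conjugate algebra. -/
def toConj (A : Type*) [Ring A] : A ≃+* Conj A := RingEquiv.refl A

lemma smul_toConj (c : ℂ) (x : B) : c • toConj B x = toConj B ((starRingEnd ℂ) c • x) := by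
  rw [Algebra.smul_def, Algebra.smul_def]; rfl

lemma qSerre_toConj (v : ℂ) (r : ℕ) (x y : B) :
    qSerre v r (toConj B x) (toConj B y) = toConj B (qSerre ((starRingEnd ℂ) v) r x y) := by
  simp only [qSerre, map_sum, ← map_mul, ← map_pow, smul_toConj]
  simp [conj_qBinom]

lemma Relations.toConj {e f k k' : I → B} (h : Relations D q e f k k') :
    Relations D q (fun i => toConj B (e i)) (fun i => toConj B (f i)) (fun i => toConj B (k i))
      (fun i => toConj B (k' i)) := by
  refine ⟨fun i => ?_, fun i => ?_, fun i j => ?_, fun i j => ?_, fun i j => ?_, fun i => ?_,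
    fun i j hij => ?_, fun i j hij => ?_, fun i j hij => ?_⟩
  · rw [← map_mul, h.k_k', map_one]
  · rw [← map_mul, h.k'_k, map_one]
  · rw [← map_mul, h.k_comm, map_mul]
  · rw [← map_mul, h.k_e, ← map_mul, smul_toConj, map_zpow₀, conj_qi]
  · rw [← map_mul, h.k_f, ← map_mul, smul_toConj, map_zpow₀, conj_qi]
  · rw [← map_mul, ← map_mul, ← map_sub, h.e_f_same, ← map_sub, smul_toConj]
    simp [conj_qi]
  · rw [← map_mul, h.e_f_ne i j hij, map_mul]
  · rw [qSerre_toConj, conj_qi, h.serre_e i j hij, map_zero]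
  · rw [qSerre_toConj, conj_qi, h.serre_f i j hij, map_zero]

/-- The antilinear anti-automorphism with `K_i ↦ K_i`, `E_i ↦ K_i F_i`, `F_i ↦ E_i K_i⁻¹`, as an
algebra homomorphism to the complex conjugate of the opposite algebra. -/
def starHom : Uq D q →ₐ[ℂ] Conj (Uq D q)ᵐᵒᵖ := lift _ _ _ _ relations_star.toConj

/-- The `*`-structure of the compact real form. -/
instance : Star (Uq D q) := ⟨fun X => ((toConj (Uq D q)ᵐᵒᵖ).symm (starHom X)).unop⟩

lemma star_def (X : Uq D q) : star X = ((toConj (Uq D q)ᵐᵒᵖ).symm (starHom X)).unop := rfl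

lemma star_smul (c : ℂ) (X : Uq D q) : star (c • X) = (starRingEnd ℂ) c • star X := by
  rw [star_def, star_def, map_smul]
  have h := smul_toConj c ((toConj (Uq D q)ᵐᵒᵖ).symm (starHom X))
  rw [RingEquiv.apply_symm_apply] at h
  rw [h, RingEquiv.symm_apply_apply, MulOpposite.unop_smul]

end Uq
end Uq


section Coordinate
variable {I : Type*} (D : CartanDatum I) (q : ℝˣ)

/-- The full linear dual of `U_q(𝔤)` with the convolution product
`(φ ψ)(X) = (φ ⊗ ψ)(Δ X)` and unit `ε`. -/
abbrev UqDual : Type _ := WithConv (Uq D q →ₗ[ℂ] ℂ)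

variable {D q} in
/-- A finite-dimensional (type 1) representation written in a basis of weight vectors: `K_i` acts on
the `k`-th basis vector, of weight `μ_k`, by `q ^ (α_i, μ_k) = q_i ^ μ_k(α_i^∨)`, with
`wt k i = μ_k(α_i^∨)` an integer. -/
def IsWeightRep {n : Type*} [Fintype n] [DecidableEq n]
    (π : Uq D q →ₐ[ℂ] Matrix n n ℂ) : Prop :=
  ∃ wt : n → I → ℤ, ∀ i, π (Uq.K D q i) = Matrix.diagonal fun k => D.qi q i ^ wt k i

/-- The matrix coefficients, in bases of weight vectors, of the finite-dimensional type 1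
representations. All other matrix coefficients `X ↦ f (X • v)` are combinations of these. -/
def matrixCoeffs : Set (UqDual D q) :=
  {φ | ∃ (n : ℕ) (π : Uq D q →ₐ[ℂ] Matrix (Fin n) (Fin n) ℂ), IsWeightRep π ∧
    ∃ k l, ∀ X, φ.ofConv X = π X k l}

variable {D q}

lemma mem_matrixCoeffs {n : Type*} [Fintype n] [DecidableEq n]
    (π : Uq D q →ₐ[ℂ] Matrix n n ℂ) (hπ : IsWeightRep π) (k l : n) (φ : UqDual D q)
    (hφ : ∀ X, φ.ofConv X = π X k l) : φ ∈ matrixCoeffs D q := by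
  let e := Fintype.equivFin n
  obtain ⟨wt, hwt⟩ := hπ
  refine ⟨Fintype.card n, (Matrix.reindexAlgEquiv ℂ ℂ e).toAlgHom.comp π, ⟨wt ∘ e.symm, ?_⟩,
    e k, e l, fun X => ?_⟩
  · intro i
    simp [hwt, Function.comp_def]
  · simp [hφ]

open TensorProduct in
lemma mul_mem_matrixCoeffs {φ ψ : UqDual D q} (hφ : φ ∈ matrixCoeffs D q)
    (hψ : ψ ∈ matrixCoeffs D q) : φ * ψ ∈ matrixCoeffs D q := by
  obtain ⟨n, π, ⟨w, hw⟩, k, l, h⟩ := hφ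
  obtain ⟨n', π', ⟨w', hw'⟩, k', l', h'⟩ := hψ
  let Φ : Uq D q ⊗[ℂ] Uq D q →ₐ[ℂ] Matrix (Fin n × Fin n') (Fin n × Fin n') ℂ :=
    (Matrix.kroneckerAlgEquiv (Fin n) (Fin n') ℂ).toAlgHom.comp (Algebra.TensorProduct.map π π')
  have hΦ : ∀ x y, Φ (x ⊗ₜ y) = Matrix.kronecker (π x) (π' y) := by
    intro x y
    simp [Φ]
  refine mem_matrixCoeffs (Φ.comp Uq.comul) ⟨fun p i => w p.1 i + w' p.2 i, fun i => ?_⟩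
    (k, k') (l, l') _ fun X => ?_
  · simp only [AlgHom.comp_apply, Uq.comul, Uq.lift_K, hΦ, hw, hw']
    rw [Matrix.kronecker, Matrix.diagonal_kronecker_diagonal]
    simp [zpow_add₀ (Uq.qi_ne_zero D q i)]
  · change (LinearMap.mul' ℂ ℂ ∘ₗ TensorProduct.map φ.ofConv ψ.ofConv) (Uq.comul X) = _
    rw [AlgHom.comp_apply]
    generalize (Uq.comul X) = z
    induction z using TensorProduct.induction_on with
    | zero => simp
    | tmul x y => simp [hΦ, h, h', Matrix.kronecker, Matrix.kroneckerMap_apply]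
    | add x y hx hy => rw [map_add, map_add, hx, hy, Matrix.add_apply]

lemma one_mem_matrixCoeffs : (1 : UqDual D q) ∈ matrixCoeffs D q := by
  refine mem_matrixCoeffs (n := Fin 1)
    ((Matrix.scalarAlgHom (Fin 1) ℂ (α := ℂ)).comp Uq.counit)
    ⟨fun _ _ => 0, fun i => ?_⟩ 0 0 _ fun X => ?_
  · simp [Uq.counit]
  · change Algebra.linearMap ℂ ℂ (Uq.counit X) = _
    simp

variable (D q) in
/-- The quantized coordinate ring `ℂ_q[G]`: the span of the matrix coefficients of the
finite-dimensional representations, with the convolution product. -/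
def Cq : Subalgebra ℂ (UqDual D q) :=
  (Submodule.span ℂ (matrixCoeffs D q)).toSubalgebra
    (Submodule.subset_span one_mem_matrixCoeffs) (by
      intro x y hx hy
      induction hx, hy using Submodule.span_induction₂ with
      | mem_mem x y hx hy => exact Submodule.subset_span (mul_mem_matrixCoeffs hx hy)
      | zero_left y _ => simp
      | zero_right x _ => simp
      | add_left x y z _ _ _ h1 h2 => rw [add_mul]; exact add_mem h1 h2
      | add_right x y z _ _ _ h1 h2 => rw [mul_add]; exact add_mem h1 h2
      | smul_left r x y _ _ h => rw [smul_mul_assoc]; exact Submodule.smul_mem _ _ h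
      | smul_right r x y _ _ h => rw [mul_smul_comm]; exact Submodule.smul_mem _ _ h)

lemma mem_Cq {φ : UqDual D q} : φ ∈ Cq D q ↔ φ ∈ Submodule.span ℂ (matrixCoeffs D q) := Iff.rfl

namespace Cq

/-- Evaluation of `φ ∈ ℂ_q[G]` on `X ∈ U_q(𝔤)`. -/
def eval (X : Uq D q) : Cq D q →ₗ[ℂ] ℂ where
  toFun φ := φ.1.ofConv X
  map_add' _ _ := rfl
  map_smul' _ _ := rfl

variable (D q) in
/-- The counit `ε(φ) = φ(1)`. -/
def counit : Cq D q →ₗ[ℂ] ℂ := eval 1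

/-- `φ ↦ (Y ↦ φ(Y X))` on the full dual. -/
def dualAct (X : Uq D q) : UqDual D q →ₗ[ℂ] UqDual D q where
  toFun φ := WithConv.toConv (φ.ofConv ∘ₗ LinearMap.mulRight ℂ X)
  map_add' _ _ := rfl
  map_smul' _ _ := rfl

lemma dualAct_mem (X : Uq D q) {φ : UqDual D q} (hφ : φ ∈ Cq D q) : dualAct X φ ∈ Cq D q := by
  rw [mem_Cq] at hφ ⊢
  induction hφ using Submodule.span_induction with
  | zero => simp
  | add x y _ _ hx hy => rw [map_add]; exact add_mem hx hy
  | smul c x _ hx => rw [map_smul]; exact Submodule.smul_mem _ _ hx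
  | mem x hx =>
    obtain ⟨n, π, hπ, k, l, h⟩ := hx
    have : dualAct X x = ∑ m, π X m l • WithConv.toConv
        ((Matrix.entryLinearMap ℂ ℂ k m) ∘ₗ π.toLinearMap) := by
      ext Y
      change x.ofConv (Y * X) = _
      simp [h, Matrix.mul_apply, mul_comm]
    rw [this]
    refine Submodule.sum_mem _ fun m _ => Submodule.smul_mem _ _ (Submodule.subset_span ?_)
    exact ⟨n, π, hπ, k, m, fun _ => rfl⟩

/-- The left action `(X ▷ φ)(Y) = φ(Y X)`. -/
def act (X : Uq D q) : Cq D q →ₗ[ℂ] Cq D q where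
  toFun φ := ⟨dualAct X φ.1, dualAct_mem X φ.2⟩
  map_add' _ _ := rfl
  map_smul' _ _ := rfl

/-- The map `X ↦ S(X)^*`. -/
def dagger : Uq D q →+* Uq D q where
  toFun X := star (Uq.antipode X)
  map_zero' := by simp [Uq.antipode, Uq.star_def]
  map_one' := by simp [Uq.antipode, Uq.star_def]
  map_add' x y := by simp [Uq.antipode, Uq.star_def]
  map_mul' x y := by simp [Uq.antipode, Uq.star_def]

lemma dagger_smul (c : ℂ) (X : Uq D q) : dagger (c • X) = (starRingEnd ℂ) c • dagger X := by
  change star (Uq.antipode (c • X)) = _ • star (Uq.antipode X)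
  have h1 : Uq.antipode (c • X) = c • Uq.antipode X := by simp [Uq.antipode]
  rw [h1, Uq.star_smul]

lemma dagger_K (i : I) : dagger (Uq.K D q i) = Uq.Kinv D q i := by
  simp [dagger, Uq.antipode, Uq.star_def, Uq.antipodeHom, Uq.starHom]

/-- The functional `φ^*(X) = conj (φ(S(X)^*))`. -/
def dualStar (φ : UqDual D q) : UqDual D q := WithConv.toConv
  { toFun := fun X => (starRingEnd ℂ) (φ.ofConv (star (Uq.antipode X)))
    map_add' := fun X Y => by
      change (starRingEnd ℂ) (φ.ofConv (dagger (X + Y))) = _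
      rw [map_add, map_add, map_add]; rfl
    map_smul' := fun c X => by
      change (starRingEnd ℂ) (φ.ofConv (dagger (c • X))) = _
      rw [dagger_smul, map_smul]
      simp only [smul_eq_mul, map_mul, Complex.conj_conj, RingHom.id_apply]
      rfl }

lemma dualStar_mem {φ : UqDual D q} (hφ : φ ∈ Cq D q) : dualStar φ ∈ Cq D q := by
  rw [mem_Cq] at hφ ⊢
  induction hφ using Submodule.span_induction with
  | zero =>
    have : dualStar (0 : UqDual D q) = 0 := by ext X; simp [dualStar]
    rw [this]; exact Submodule.zero_mem _
  | add x y _ _ hx hy =>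
    have : dualStar (x + y) = dualStar x + dualStar y := by ext X; simp [dualStar]
    rw [this]; exact add_mem hx hy
  | smul c x _ hx =>
    have : dualStar (c • x) = (starRingEnd ℂ) c • dualStar x := by ext X; simp [dualStar]
    rw [this]; exact Submodule.smul_mem _ _ hx
  | mem x hx =>
    obtain ⟨n, π, ⟨w, hw⟩, k, l, h⟩ := hx
    apply Submodule.subset_span
    let π' : Uq D q →ₐ[ℂ] Matrix (Fin n) (Fin n) ℂ :=
      { ((starRingEnd ℂ).mapMatrix.comp π.toRingHom).comp dagger with
        commutes' := fun c => by
          change (π (dagger (algebraMap ℂ (Uq D q) c))).map (starRingEnd ℂ) = _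
          rw [Algebra.algebraMap_eq_smul_one, dagger_smul, map_one, map_smul, map_one]
          ext a b
          by_cases hab : a = b <;>
            simp [Matrix.algebraMap_matrix_apply, hab] }
    have hπ' : ∀ X, π' X = (π (dagger X)).map (starRingEnd ℂ) := fun X => rfl
    refine ⟨n, π', ⟨fun k i => - w k i, fun i => ?_⟩, k, l, fun X => ?_⟩
    · have h1 : π (Uq.Kinv D q i) = Matrix.diagonal fun k => D.qi q i ^ (-w k i) := by
        calc π (Uq.Kinv D q i)
            = π (Uq.Kinv D q i) * (π (Uq.K D q i) *
                Matrix.diagonal fun k => D.qi q i ^ (-w k i)) := by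
              rw [hw, Matrix.diagonal_mul_diagonal]
              simp [mul_inv_cancel₀ (zpow_ne_zero _ (Uq.qi_ne_zero D q i))]
          _ = _ := by
              rw [← mul_assoc, ← map_mul, Uq.relations.k'_k, map_one, one_mul]
      rw [hπ', dagger_K, h1]
      ext a b
      by_cases hab : a = b <;> simp [hab, map_zpow₀, Uq.conj_qi]
    · change (starRingEnd ℂ) (x.ofConv (dagger X)) = _
      rw [h, hπ']; rfl

/-- The `*`-structure of `ℂ_q[G]`, `φ^*(X) = conj (φ(S(X)^*))`. -/
instance : Star (Cq D q) := ⟨fun φ => ⟨dualStar φ.1, dualStar_mem φ.2⟩⟩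

end Cq
end Coordinate


section Lie
open LieAlgebra LieAlgebra.IsKilling LieModule
variable {𝔤 : Type*} [LieRing 𝔤] [LieAlgebra ℂ 𝔤] [FiniteDimensional ℂ 𝔤] [IsSimple ℂ 𝔤]
variable (H : LieSubalgebra ℂ 𝔤) [H.IsCartanSubalgebra]

/-- The bilinear form on `𝔥^*` induced by the Killing form. -/
def killingDual : LinearMap.BilinForm ℂ (Module.Dual ℂ H) :=
  ((killingForm ℂ 𝔤).restrict H).compl₁₂ (cartanEquivDual H).symm.toLinearMap
    (cartanEquivDual H).symm.toLinearMap

variable {H}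

lemma killingDual_apply (l m : Module.Dual ℂ H) :
    killingDual H l m = l ((cartanEquivDual H).symm m) := by
  have : cartanEquivDual H ((cartanEquivDual H).symm l) ((cartanEquivDual H).symm m)
      = l ((cartanEquivDual H).symm m) := by rw [LinearEquiv.apply_symm_apply]
  rw [← this]
  rfl

lemma killingDual_symm (l m : Module.Dual ℂ H) : killingDual H l m = killingDual H m l :=
  LieModule.traceForm_comm ℂ 𝔤 𝔤 _ _

lemma killingDual_root_ne_zero (α : H.root) :
    killingDual H ((rootSystem H).root α) ((rootSystem H).root α) ≠ 0 := by
  rw [killingDual_apply]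
  exact root_apply_cartanEquivDual_symm_ne_zero (LieSubalgebra.isNonZero_coe_root α)

lemma killingDual_root (l : Module.Dual ℂ H) (α : H.root) :
    2 * killingDual H l ((rootSystem H).root α)
      = l ((rootSystem H).coroot α)
        * killingDual H ((rootSystem H).root α) ((rootSystem H).root α) := by
  have h0 := killingDual_root_ne_zero α
  have h1 : (rootSystem H).coroot α = (2 : ℂ) •
      (killingDual H ((rootSystem H).root α) ((rootSystem H).root α))⁻¹ •
        (cartanEquivDual H).symm ((rootSystem H).root α) := by
    rw [killingDual_apply]
    change coroot (α : Weight ℂ H 𝔤) = _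
    rw [coroot, ofNat_smul_eq_nsmul ℂ 2]
    rfl
  rw [h1, map_smul, map_smul, ← killingDual_apply]
  simp only [smul_eq_mul]
  field_simp

lemma killingDual_root_pos (α : H.root) : ∃ t : ℝ, 0 < t ∧
    killingDual H ((rootSystem H).root α) ((rootSystem H).root α) = t := by
  set B := killingDual H ((rootSystem H).root α) ((rootSystem H).root α) with hB
  have h0 : B ≠ 0 := killingDual_root_ne_zero α
  let S : ℤ := ∑ γ : H.root, ((rootSystem H).pairingIn ℤ γ α) ^ 2
  have hS : 0 < S := by
    refine lt_of_lt_of_le (b := ((rootSystem H).pairingIn ℤ α α) ^ 2) (by simp) ?_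
    exact Finset.single_le_sum (f := fun γ => ((rootSystem H).pairingIn ℤ γ α) ^ 2)
      (fun i _ => sq_nonneg _) (Finset.mem_univ α)
  have h1 : (killingForm ℂ 𝔤).restrict H ((rootSystem H).coroot α) ((rootSystem H).coroot α)
      = (S : ℂ) := by
    rw [← corootForm_rootSystem_eq_killing, RootPairing.corootForm_apply_apply]
    push_cast [S]
    refine Finset.sum_congr rfl fun γ _ => ?_
    have := (rootSystem H).algebraMap_pairingIn ℤ γ α
    rw [sq, RootPairing.root'_coroot_eq_pairing, ← this]
    simp
  have h2 : (killingForm ℂ 𝔤).restrict H ((rootSystem H).coroot α) ((rootSystem H).coroot α)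
      = 4 * B⁻¹ := by
    have h3 := traceForm_coroot (α : Weight ℂ H 𝔤) (coroot (α : Weight ℂ H 𝔤))
    rw [root_apply_coroot (LieSubalgebra.isNonZero_coe_root α)] at h3
    refine Eq.trans h3 ?_
    rw [hB, killingDual_apply, nsmul_eq_mul, smul_eq_mul]
    change _ = 4 * ((α : Weight ℂ H 𝔤) ((cartanEquivDual H).symm _))⁻¹
    push_cast
    ring_nf
    rfl
  refine ⟨4 / S, by positivity, ?_⟩
  have h4 : 4 * B⁻¹ = (S : ℂ) := h2.symm.trans h1
  have h5 : (S : ℂ) ≠ 0 := by exact_mod_cast hS.ne'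
  push_cast
  rw [eq_div_iff h5, ← h4]
  field_simp

variable (H) in
/-- The induced form as an invariant form of the root system. -/
def killingInvariantForm : (rootSystem H).InvariantForm where
  form := killingDual H
  symm := ⟨fun l m => killingDual_symm l m⟩
  ne_zero := killingDual_root_ne_zero
  isOrthogonal_reflection α l m := by
    have h1 := killingDual_root l α
    have h2 := killingDual_root m α
    have hr : ∀ x : Module.Dual ℂ H, (rootSystem H).reflection α x
        = x - x ((rootSystem H).coroot α) • (rootSystem H).root α := fun x => rfl
    rw [hr, hr]
    simp only [map_sub, map_smul, LinearMap.sub_apply, LinearMap.smul_apply, smul_eq_mul]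
    rw [killingDual_symm ((rootSystem H).root α) m]
    linear_combination (-m ((rootSystem H).coroot α) / 2) * h1
      - (l ((rootSystem H).coroot α) / 2) * h2

variable (H) in
/-- Squared length (for the Killing form) of the short roots. -/
def shortSq : ℝ :=
  ⨅ α : H.root, (killingDual H ((rootSystem H).root α) ((rootSystem H).root α)).re

variable (H) in
/-- The form on `𝔥^*` induced by the Killing form, normalized so that `(α, α) = 2` for every
short root `α`. -/
def form : LinearMap.BilinForm ℂ (Module.Dual ℂ H) := ((2 / shortSq H : ℝ) : ℂ) • killingDual H

lemma form_symm (l m : Module.Dual ℂ H) : form H l m = form H m l := by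
  simp [form, killingDual_symm l m]

lemma form_root (l : Module.Dual ℂ H) (α : H.root) :
    2 * form H l ((rootSystem H).root α) = l ((rootSystem H).coroot α)
        * form H ((rootSystem H).root α) ((rootSystem H).root α) := by
  have := killingDual_root l α
  simp only [form, LinearMap.smul_apply, smul_eq_mul]
  linear_combination ((2 / shortSq H : ℝ) : ℂ) * this

lemma exists_form_root_eq (α : H.root) : ∃ n : ℕ,
    form H ((rootSystem H).root α) ((rootSystem H).root α) = 2 * n := by
  choose t ht hB using killingDual_root_pos (H := H)
  have : Nonempty H.root := ⟨α⟩
  obtain ⟨β, hβ⟩ := exists_eq_ciInf_of_finite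
    (f := fun α : H.root => (killingDual H ((rootSystem H).root α) ((rootSystem H).root α)).re)
  have hs : shortSq H = t β := by
    rw [shortSq, ← hβ, hB, Complex.ofReal_re]
  have hle : t β ≤ t α := by
    have := ciInf_le (Set.finite_range
      (fun α : H.root => (killingDual H ((rootSystem H).root α) ((rootSystem H).root α)).re)).bddBelow α
    change shortSq H ≤ _ at this
    rwa [hs, hB, Complex.ofReal_re] at this
  have hb := ht β
  have ha := ht α
  have key := (killingInvariantForm H).apply_eq_or α β
  simp only [killingInvariantForm, hB] at key
  norm_cast at key
  have hf : form H ((rootSystem H).root α) ((rootSystem H).root α) = ((2 / t β * t α : ℝ) : ℂ) := by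
    simp only [form, LinearMap.smul_apply, smul_eq_mul, hB, hs]
    push_cast; ring
  rcases key with h | h | h | h | h
  · exact ⟨1, by rw [hf, h]; field_simp; simp⟩
  · exact ⟨2, by rw [hf, h]; field_simp; norm_cast⟩
  · exact ⟨3, by rw [hf, h]; field_simp; norm_cast⟩
  · linarith
  · linarith

variable (b : (rootSystem H).Base)

/-- `d_i = (α_i, α_i) / 2`. -/
def rootD (i : b.support) : ℕ := (exists_form_root_eq (i : H.root)).choose

lemma form_root_self (i : b.support) :
    form H ((rootSystem H).root i) ((rootSystem H).root i) = 2 * rootD b i :=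
  (exists_form_root_eq (i : H.root)).choose_spec

lemma form_simpleRoot (i : b.support) (l : Module.Dual ℂ H) :
    form H ((rootSystem H).root i) l = rootD b i * l ((rootSystem H).coroot i) := by
  have h := form_root l (i : H.root)
  rw [form_root_self] at h
  rw [form_symm]
  linear_combination h / 2

/-- The datum of `𝔤`: `a_ij = α_j(α_i^∨)`, so that `(α_i, α_j) = d_i a_ij`. -/
def lieDatum : CartanDatum b.support where
  a i j := b.cartanMatrix j i
  d := rootD b
  symm i j := by
    have h : ∀ i j : b.support, ((rootD b i * b.cartanMatrix j i : ℤ) : ℂ)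
        = form H ((rootSystem H).root i) ((rootSystem H).root j) := by
      intro i j
      rw [form_simpleRoot]
      push_cast
      congr 1
      exact b.algebraMap_cartanMatrixIn_apply ℤ j i
    have := (h i j).trans ((form_symm _ _).trans (h j i).symm)
    exact_mod_cast this
  diag i := b.cartanMatrix_apply_same i
  nonpos i j hij := b.cartanMatrix_le_zero_of_ne j i hij.symm

/-- The half-sum of the positive roots. -/
def rho : Module.Dual ℂ H := by
  classical
  exact (1 / 2 : ℂ) • ∑ α : H.root with b.IsPos α, (rootSystem H).root α

end Lie


section Pairing
open LieAlgebra LieAlgebra.IsKilling TensorProduct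

/-- The chain `Tr (V (2 P - Id) ⊗ P ⊗ P) = ∑_{i,k,l} (V (2 P - Id))^i_k ⊗ P^k_l ⊗ P^l_i`. -/
def hochschildChain {A : Type*} [Ring A] [Algebra ℂ A] {N : ℕ} (V : Matrix (Fin N) (Fin N) ℂ)
    (P : Matrix (Fin N) (Fin N) A) : A ⊗[ℂ] (A ⊗[ℂ] A) :=
  ∑ i, ∑ k, ∑ l, (V.map (algebraMap ℂ A) * (2 • P - 1) : Matrix (Fin N) (Fin N) A) i k ⊗ₜ[ℂ] (P k l ⊗ₜ[ℂ] P l i)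

section
variable {I : Type*} (D : CartanDatum I) (q : ℝˣ)

/-- The functional `η_{X,Y}(a₀ ⊗ a₁ ⊗ a₂) = ε(a₀) ε(X ▷ a₁) ε(Y ▷ a₂)`. -/
def etaXY (X Y : Uq D q) : Cq D q ⊗[ℂ] (Cq D q ⊗[ℂ] Cq D q) →ₗ[ℂ] ℂ :=
  LinearMap.mul' ℂ ℂ ∘ₗ TensorProduct.map (Cq.counit D q)
    (LinearMap.mul' ℂ ℂ ∘ₗ TensorProduct.map (Cq.counit D q ∘ₗ Cq.act X)
      (Cq.counit D q ∘ₗ Cq.act Y))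

/-- The cocycle `η_a = η_{F_a, E_a}`. -/
def eta (a : I) : Cq D q ⊗[ℂ] (Cq D q ⊗[ℂ] Cq D q) →ₗ[ℂ] ℂ :=
  etaXY D q (Uq.F D q a) (Uq.E D q a)

variable {D q} in
/-- `K_i` as a unit. -/
def Uq.Kunit (i : I) : (Uq D q)ˣ :=
  ⟨Uq.K D q i, Uq.Kinv D q i, Uq.relations.k_k' i, Uq.relations.k'_k i⟩

/-- `K_1 ^ n_1 ⋯ K_r ^ n_r`. -/
def Uq.Kmonomial [Fintype I] (n : I → ℤ) : Uq D q :=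
  (Finset.univ.noncommProd (fun i => (Uq.Kunit i : (Uq D q)ˣ) ^ n i)
    (fun i _ j _ _ => ((show Commute (Uq.Kunit i : (Uq D q)ˣ) (Uq.Kunit j) from
      Units.ext (Uq.relations.k_comm i j)).zpow_zpow (n i) (n j))) : (Uq D q)ˣ)

end

/-- The quantum number `[x]_p = (p ^ x - p ^ (-x)) / (p - p⁻¹)`. -/
def qNumber (p x : ℂ) : ℂ := (p ^ x - p ^ (-x)) / (p - p⁻¹)

variable {𝔤 : Type*} [LieRing 𝔤] [LieAlgebra ℂ 𝔤] [FiniteDimensional ℂ 𝔤] [IsSimple ℂ 𝔤]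
variable {H : LieSubalgebra ℂ 𝔤} [H.IsCartanSubalgebra] (b : (rootSystem H).Base) (q : ℝˣ)

/-- The quantized enveloping algebra `U_q(𝔤)`. -/
abbrev UqG : Type _ := Uq (lieDatum b) q

/-- The quantized coordinate ring `ℂ_q[G]`. -/
abbrev CqG : Type _ := Cq (lieDatum b) q

open Classical in
/-- `K_λ = K_1 ^ n_1 ⋯ K_r ^ n_r` for `λ = ∑ n_i α_i` in the root lattice (the `n_i` are unique,
as the simple roots are linearly independent); set to `1` outside the root lattice. -/
def Klam (l : Module.Dual ℂ H) : UqG b q :=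
  if h : ∃ n : b.support → ℤ, l = ∑ i, (n i : ℂ) • (rootSystem H).root i then
    Uq.Kmonomial (lieDatum b) q h.choose
  else 1

section Rep
variable (V : Type*) [NormedAddCommGroup V] [InnerProductSpace ℂ V] [Module (UqG b q) V]

/-- The inner product makes `V` a `*`-representation of the compact real form. -/
def IsUnitary : Prop :=
  ∀ (X : UqG b q) (v w : V), inner ℂ (X • v) w = inner ℂ v (star X • w)

/-- `Λ` is dominant integral and `V` has a highest weight vector of weight `Λ`; so an irreducible `V`
with this property is `V(Λ)`. -/
def HasHighestWeight (Λ : Module.Dual ℂ H) : Prop :=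
  (∀ i : b.support, ∃ n : ℕ, Λ ((rootSystem H).coroot i) = n) ∧
  ∃ v : V, v ≠ 0 ∧ ∀ i : b.support, Uq.E (lieDatum b) q i • v = 0 ∧
    Uq.K (lieDatum b) q i • v = ((q : ℝ) : ℂ) ^ form H ((rootSystem H).root i) Λ • v

/-- An orthonormal basis `v_i` of `V` of weight vectors, `v_i` having the integral weight
`λ_i = wt i`, that is `K_j v_i = q ^ (α_j, λ_i) v_i`. -/
structure WeightBasis (N : ℕ) where
  v : OrthonormalBasis (Fin N) ℂ V
  wt : Fin N → Module.Dual ℂ H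
  integral : ∀ i (j : b.support), ∃ n : ℤ, wt i ((rootSystem H).coroot j) = n
  K_smul : ∀ i (j : b.support), Uq.K (lieDatum b) q j • v i
    = ((q : ℝ) : ℂ) ^ form H ((rootSystem H).root j) (wt i) • v i

namespace WeightBasis
variable {b q V} [IsScalarTower ℂ (UqG b q) V] {N : ℕ} (β : WeightBasis b q V N)

/-- The matrices `π(X)`: `X v_j = ∑_i π(X)^i_j v_i`. -/
def rep : UqG b q →ₐ[ℂ] Matrix (Fin N) (Fin N) ℂ :=
  (LinearMap.toMatrixAlgEquiv β.v.toBasis).toAlgHom.comp (Algebra.lsmul ℂ ℂ V)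

lemma rep_apply (X : UqG b q) (i j : Fin N) : β.rep X i j = β.v.repr (X • β.v j) i := by
  simp [rep, LinearMap.toMatrixAlgEquiv_apply]

lemma isWeightRep : IsWeightRep β.rep := by
  choose n hn using β.integral
  refine ⟨n, fun j => ?_⟩
  ext k l
  rw [rep_apply, β.K_smul, form_simpleRoot, hn, map_smul]
  have h : ((q : ℝ) : ℂ) ^ ((rootD b j : ℂ) * (n l j : ℂ)) = (lieDatum b).qi q j ^ n l j := by
    rw [CartanDatum.qi, Complex.cpow_mul_int]
    norm_cast
  rw [h]
  by_cases hkl : k = l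
  · subst hkl; simp
  · simp [hkl]

/-- The matrix coefficient `u^i_j(X) = f^i(X v_j)`, with `f^i` the dual basis. -/
def u (i j : Fin N) : CqG b q :=
  ⟨WithConv.toConv ((Matrix.entryLinearMap ℂ ℂ i j) ∘ₗ β.rep.toLinearMap),
    Submodule.subset_span (mem_matrixCoeffs β.rep β.isWeightRep i j _ fun _ => rfl)⟩

/-- The matrix `N^n_m` with entries `(N^n_m)^i_j = u^i_m (u^j_n)^*`. -/
def Nmat (m n : Fin N) : Matrix (Fin N) (Fin N) (CqG b q) :=
  Matrix.of fun i j => β.u i m * star (β.u j n)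

/-- `Q = ∑ c^m_n N^n_m`, where `c^m_n = c m n`. -/
def Q (c : Matrix (Fin N) (Fin N) ℂ) : Matrix (Fin N) (Fin N) (CqG b q) :=
  ∑ m, ∑ n, c m n • β.Nmat m n

/-- The twisted 2-cycle `C(Q) = Tr (π(K_{2ρ}) (2 Q - Id) ⊗ Q ⊗ Q)`. -/
def CQ (c : Matrix (Fin N) (Fin N) ℂ) : CqG b q ⊗[ℂ] (CqG b q ⊗[ℂ] CqG b q) :=
  hochschildChain (β.rep (Klam b q ((2 : ℂ) • rho b))) (β.Q c)

end WeightBasis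
end Rep
end Pairing

end QFlag

end

/-! Evaluating the matrix $\mathsf Q$ entrywise at $X\in U_q(\mathfrak g)$ gives the adjoint action
on the scalar matrix $c$, namely $\sum\pi(X_{(1)})\,c\,\pi(S(X_{(2)}))$ (`map_eval_Q`). This is
where unitarity enters: it turns $(u^j_n)^*(Y)$ into $\pi(S(Y))^n_j$. At $X=1$ the value is $c$, and
since the counit is multiplicative, $c^2=c$. At $E_a$ the value is $[E_a,c]K_a^{-1}$; at $F_a$ it is
$[F_a,c]$, because $c$ preserves weights and so commutes with $K_a$.

Hence $\eta_a(C(\mathsf Q))=\mathrm{Tr}\big(M(2c-1)[F_a,c][E_a,c]\big)$ with $M=K_a^{-1}K_{2\rho}$,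
all operators taken in $V(\Lambda)$ (`eta_CQ_eq_trace`). The matrix $M$ commutes with $c$, again by
weights, and also with $F_a$: the sum of the positive roots pairs to $2$ with $\alpha_a^\vee$
(`sum_pairing_of_isPos`), so $2\rho-\alpha_a$ is orthogonal to $\alpha_a$
(`prod_eigK_mul_of_rep_F_ne_zero`).

For an idempotent $c$ these two commutations collapse the trace to $\mathrm{Tr}(cM[E_a,F_a])$
(`trace_idempotent_commutator`). Both $M$ and $[E_a,F_a]$ are diagonal in the weight basis: on $v_i$
the first is $q^{(2\rho-\alpha_a,\lambda_i)}$ and the second is the quantum number. Only the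
diagonal entries $c^i_i$ survive. -/

namespace QFlag

/-! ### The counit of $\mathbb C_q[G]$ and the pairing of $\eta$ with Hochschild chains. -/

open TensorProduct in
/-- The counit of `ℂ_q[G]` is multiplicative. -/
lemma Cq.counit_mul {I : Type*} {D : CartanDatum I} {q : ℝˣ} (φ ψ : Cq D q) :
    Cq.counit D q (φ * ψ) = Cq.counit D q φ * Cq.counit D q ψ := by
  change (LinearMap.mul' ℂ ℂ ∘ₗ TensorProduct.map φ.1.ofConv ψ.1.ofConv) (Uq.comul 1) = _
  rw [map_one, Algebra.TensorProduct.one_def]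
  simp only [LinearMap.comp_apply, TensorProduct.map_tmul, LinearMap.mul'_apply]
  rfl

lemma Cq.counit_one {I : Type*} {D : CartanDatum I} {q : ℝˣ} :
    Cq.counit D q 1 = 1 := by
  change Algebra.linearMap ℂ ℂ (Uq.counit 1) = _
  simp

lemma Cq.counit_sub {I : Type*} {D : CartanDatum I} {q : ℝˣ} (φ ψ : Cq D q) :
    Cq.counit D q (φ - ψ) = Cq.counit D q φ - Cq.counit D q ψ :=
  rfl

/-- As $\varepsilon$ is evaluation at $1$, the last two factors of $\eta_{X,Y}$ are plain
evaluations at $X$ and $Y$. -/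
lemma Cq.counit_act {I : Type*} {D : CartanDatum I} {q : ℝˣ} (X : Uq D q) (φ : Cq D q) :
    Cq.counit D q (Cq.act X φ) = Cq.eval X φ := by
  change φ.1.ofConv (1 * X) = φ.1.ofConv X
  rw [one_mul]

/-- The pairing of `η_{X,Y}` with a Hochschild chain is a trace of scalar matrices. -/
lemma etaXY_hochschildChain {I : Type*} {D : CartanDatum I} {q : ℝˣ} {N : ℕ} (X Y : Uq D q)
    (V : Matrix (Fin N) (Fin N) ℂ) (P : Matrix (Fin N) (Fin N) (Cq D q))
    {C₀ C₁ C₂ : Matrix (Fin N) (Fin N) ℂ} (h₀ : P.map (Cq.counit D q) = C₀)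
    (h₁ : P.map (Cq.eval X) = C₁) (h₂ : P.map (Cq.eval Y) = C₂) :
    etaXY D q X Y (hochschildChain V P) = (V * (2 • C₀ - 1) * C₁ * C₂).trace := by
  subst h₀ h₁ h₂
  -- The entries of `V` act as scalars, so linearity of the counit and $\varepsilon(1)=1$ suffice
  -- here.
  have h1 : ∀ i k, Cq.counit D q
      ((V.map (algebraMap ℂ (Cq D q)) * (2 • P - 1) : Matrix _ _ (Cq D q)) i k)
      = (V * (2 • P.map (Cq.counit D q) - 1) : Matrix (Fin N) (Fin N) ℂ) i k := by
    intro i k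
    rw [Matrix.mul_apply, Matrix.mul_apply, map_sum]
    refine Finset.sum_congr rfl fun m _ => ?_
    rw [Matrix.map_apply, ← Algebra.smul_def, map_smul, smul_eq_mul]
    congr 1
    rw [Matrix.sub_apply, Matrix.smul_apply, Matrix.sub_apply, Matrix.smul_apply,
      Matrix.map_apply]
    refine (Cq.counit_sub _ _).trans (congr_arg₂ _ (map_nsmul _ _ _) ?_)
    rw [Matrix.one_apply, Matrix.one_apply]
    split_ifs
    · exact Cq.counit_one
    · exact map_zero _
  rw [hochschildChain, Matrix.mul_assoc _ (P.map _)]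
  simp only [map_sum, etaXY, LinearMap.comp_apply, TensorProduct.map_tmul, LinearMap.mul'_apply,
    Cq.counit_act, h1]
  generalize V * (2 • P.map (Cq.counit D q) - 1) = W
  simp only [Matrix.trace, Matrix.diag_apply, Matrix.mul_apply, Matrix.map_apply, Finset.mul_sum]

/-! ### A trace identity for idempotents. -/

section Trace
variable {n R : Type*} [Fintype n] [DecidableEq n] [CommRing R]

/-- A twisted form of the Chern character of an idempotent `c` paired with two inner
derivations. -/
lemma trace_idempotent_commutator (c M X Y : Matrix n n R) (hc : c * c = c)
    (hM : M * c = c * M) (hX : M * X = X * M) :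
    (M * (2 • c - 1) * (X * c - c * X) * (Y * c - c * Y)).trace
      = (c * M * (Y * X - X * Y)).trace := by
  -- Pure expansion with $c^2=c$; the brackets are placed so that each outer $c$ is ready to be
  -- rotated under the trace.
  have key : (2 • c - 1) * (X * c - c * X) * (Y * c - c * Y)
      = 2 • ((c * X * c * Y) * c) - c * X * c * Y - c * (X * Y * c) - (X * c * Y) * c
        + X * c * Y := by
    have h (Z : Matrix n n R) : c * (c * Z) = c * Z := by rw [← mul_assoc, hc]
    simp only [two_nsmul, mul_sub, sub_mul, add_mul, mul_assoc, h, one_mul]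
    abel
  -- Cyclicity and $Mc=cM$: a factor $c$ at the right end may reappear just after $M$.
  have rot (Z : Matrix n n R) : (M * (Z * c)).trace = (M * (c * Z)).trace := by
    rw [← mul_assoc, Matrix.trace_mul_comm, ← mul_assoc, ← hM, mul_assoc]
  have h (Z : Matrix n n R) : c * (c * Z) = c * Z := by rw [← mul_assoc, hc]
  -- The only place where $X$ has to pass $M$; no commutation of $Y$ with $M$ is required.
  have e1 : (M * (X * c * Y)).trace = (c * M * (Y * X)).trace := by
    rw [mul_assoc X, ← mul_assoc, hX, mul_assoc, Matrix.trace_mul_comm, ← mul_assoc, hM]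
    simp only [mul_assoc]
  have e2 : (M * (c * (X * Y * c))).trace = (c * M * (X * Y)).trace := by
    rw [← mul_assoc c, rot, h, ← mul_assoc, hM]
  rw [mul_assoc M, mul_assoc M, key, mul_sub (c * M), Matrix.trace_sub, ← e1, ← e2]
  -- After rotation, three terms become multiples of $\mathrm{Tr}(McXcY)$, with coefficients
  -- $2,-1,-1$, and cancel.
  simp only [mul_add, mul_sub, Matrix.trace_add, Matrix.trace_sub, Matrix.trace_smul,
    mul_smul_comm, rot (c * X * c * Y), rot (X * c * Y)]
  simp only [mul_assoc, h]
  abel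

end Trace

end QFlag

/-! ### The weight $2\rho$: its pairing with simple coroots and its place in the root lattice. -/

namespace QFlag
open LieAlgebra LieAlgebra.IsKilling
variable {𝔤 : Type*} [LieRing 𝔤] [LieAlgebra ℂ 𝔤] [FiniteDimensional ℂ 𝔤] [IsSimple ℂ 𝔤]
variable {H : LieSubalgebra ℂ 𝔤} [H.IsCartanSubalgebra] (b : (rootSystem H).Base)

/-- The sum of the positive roots pairs to `2` with every simple coroot: the simple reflection
permutes the other positive roots. -/
lemma sum_pairing_of_isPos {ι R M N : Type*} [Fintype ι] [CommRing R] [CharZero R] [IsDomain R]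
    [AddCommGroup M] [Module R M] [AddCommGroup N] [Module R N] {P : RootPairing ι R M N}
    [P.IsCrystallographic] [P.IsReduced] (b : P.Base) [DecidablePred b.IsPos] {a : ι}
    (ha : a ∈ b.support) : ∑ i with b.IsPos i, P.pairing i a = 2 := by
  classical
  have ha' : a ∈ Finset.univ.filter b.IsPos := by
    simpa using RootPairing.Base.isPos_of_mem_support ha
  have hmem : ∀ i ∈ (Finset.univ.filter b.IsPos).erase a,
      P.reflectionPerm a i ∈ (Finset.univ.filter b.IsPos).erase a := by
    intro i hi
    simp only [Finset.mem_erase, Finset.mem_filter, Finset.mem_univ, true_and] at hi ⊢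
    refine ⟨fun h => ?_, hi.2.reflectionPerm ha hi.1⟩
    -- If $s_a(i)=a$ then $i=s_a(a)=-a$, which has height $-1$ and is not positive.
    have hr : P.reflectionPerm a a = i := by
      rw [← P.reflectionPerm_self a i, h]
    have h2 := hi.2
    have h3 : b.height (P.reflectionPerm a a) = -b.height a := b.height_reflectionPerm_self a
    rw [← hr, RootPairing.Base.isPos_iff, h3,
      RootPairing.Base.height_one_of_mem_support ha] at h2
    omega
  -- Reindexing by $s_a$ flips the sign of each pairing with the coroot of $a$. The sum equals its
  -- own negative and vanishes, leaving only the contribution $2$ of $a$ itself.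
  have h1 : ∑ i ∈ (Finset.univ.filter b.IsPos).erase a, P.pairing i a
      = ∑ i ∈ (Finset.univ.filter b.IsPos).erase a, -P.pairing i a := by
    refine Finset.sum_nbij' (P.reflectionPerm a) (P.reflectionPerm a) hmem hmem ?_ ?_ ?_
    · simp
    · simp
    · intro i _
      rw [← P.pairing_reflectionPerm, P.pairing_reflectionPerm_self_right, neg_neg]
  rw [Finset.sum_neg_distrib] at h1
  rw [← Finset.add_sum_erase _ _ ha', self_eq_neg.mp h1, add_zero, P.pairing_same]

lemma two_rho_coroot (a : b.support) : ((2 : ℂ) • rho b) ((rootSystem H).coroot a) = 2 := by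
  classical
  rw [rho, smul_smul, show (2 : ℂ) * (1 / 2) = 1 by norm_num, one_smul, LinearMap.sum_apply]
  refine Eq.trans ?_ (sum_pairing_of_isPos b a.2)
  -- The filter inside `rho` carries its own decidability instance, which has to be matched.
  exact Finset.sum_congr (Finset.filter_congr_decidable ..) fun α _ => rfl

/-- Ensures that `Klam` at $2\rho$ is a genuine monomial in the $K_i$ and not its default value $1$.
-/
lemma exists_two_rho_eq : ∃ n : b.support → ℤ,
    (2 : ℂ) • rho b = ∑ i, (n i : ℂ) • (rootSystem H).root i := by
  classical
  have h (α : H.root) : ∃ n : b.support → ℤ,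
      (rootSystem H).root α = ∑ i, (n i : ℂ) • (rootSystem H).root i := by
    obtain ⟨f, -, -, hf⟩ := b.exists_root_eq_sum_int α
    refine ⟨fun i => f i, ?_⟩
    rw [hf, ← Finset.sum_coe_sort]
    simp only [Int.cast_smul_eq_zsmul]
  choose n hn using h
  refine ⟨fun i => ∑ α : H.root with b.IsPos α, n α i, ?_⟩
  rw [rho, smul_smul, show (2 : ℂ) * (1 / 2) = 1 by norm_num, one_smul]
  simp only [Int.cast_sum, Finset.sum_smul]
  rw [Finset.sum_comm]
  exact Finset.sum_congr (Finset.filter_congr_decidable ..) fun α _ => hn α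

end QFlag

/-! ### Matrix coefficients and the adjoint action on matrices. -/

namespace QFlag
open LieAlgebra LieAlgebra.IsKilling TensorProduct
variable {𝔤 : Type*} [LieRing 𝔤] [LieAlgebra ℂ 𝔤] [FiniteDimensional ℂ 𝔤] [IsSimple ℂ 𝔤]
variable {H : LieSubalgebra ℂ 𝔤} [H.IsCartanSubalgebra] {b : (rootSystem H).Base} {q : ℝˣ}

namespace Uq
variable {I : Type*} {D : CartanDatum I} {q : ℝˣ}

lemma antipode_add (X Y : Uq D q) : antipode (X + Y) = antipode X + antipode Y := by
  simp [antipode]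

lemma antipode_smul (r : ℂ) (X : Uq D q) : antipode (r • X) = r • antipode X := by
  simp [antipode]

/-- The map `X ⊗ Y ↦ π(X) c π(S(Y))`; composed with the comultiplication it is
the adjoint action on matrices. -/
noncomputable def sandwich {n : Type*} [Fintype n] [DecidableEq n] (π : Uq D q →ₐ[ℂ] Matrix n n ℂ)
    (c : Matrix n n ℂ) : Uq D q ⊗[ℂ] Uq D q →ₗ[ℂ] Matrix n n ℂ :=
  TensorProduct.lift (LinearMap.mk₂ ℂ (fun X Y => π X * c * π (antipode Y))
    (fun X X' Y => by simp [add_mul]) (fun r X Y => by simp)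
    (fun X Y Y' => by simp [antipode_add, mul_add]) (fun r X Y => by simp [antipode_smul]))

@[simp] lemma sandwich_tmul {n : Type*} [Fintype n] [DecidableEq n]
    (π : Uq D q →ₐ[ℂ] Matrix n n ℂ) (c : Matrix n n ℂ) (X Y : Uq D q) :
    sandwich π c (X ⊗ₜ Y) = π X * c * π (antipode Y) := rfl

end Uq

namespace WeightBasis
variable {V : Type*} [NormedAddCommGroup V] [InnerProductSpace ℂ V] [Module (UqG b q) V]
  [IsScalarTower ℂ (UqG b q) V] {N : ℕ} (β : WeightBasis b q V N)

/-- Unitarity makes $X^*$ act by the adjoint operator, and the basis is orthonormal. -/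
lemma rep_star (hV : IsUnitary b q V) (X : UqG b q) : β.rep (star X) = (β.rep X).conjTranspose := by
  ext i j
  rw [Matrix.conjTranspose_apply, rep_apply, rep_apply, OrthonormalBasis.repr_apply_apply,
    OrthonormalBasis.repr_apply_apply, ← hV, RCLike.star_def, inner_conj_symm]

/-- The conjugation in $\varphi^*$ cancels the one in `rep_star`, leaving
$(u^j_n)^*(Y)=\pi(S(Y))^n_j$. The convolution product then supplies
$\pi(X_{(1)})^i_m\,\pi(S(X_{(2)}))^n_j$, an entry of $\pi(X_{(1)})\,e_{mn}\,\pi(S(X_{(2)}))$ with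
$e_{mn}$ a matrix unit. -/
lemma eval_Nmat (hV : IsUnitary b q V) (m n i j : Fin N) (X : UqG b q) :
    Cq.eval X (β.Nmat m n i j) = Uq.sandwich β.rep (Matrix.single m n 1) (Uq.comul X) i j := by
  change (LinearMap.mul' ℂ ℂ ∘ₗ TensorProduct.map (β.u i m).1.ofConv (star (β.u j n)).1.ofConv)
    (Uq.comul X) = _
  generalize Uq.comul X = z
  induction z using TensorProduct.induction_on with
  | zero => simp
  | add x y hx hy => rw [map_add, map_add, hx, hy, Matrix.add_apply]
  | tmul x y =>
    have h : (star (β.u j n)).1.ofConv y = β.rep (Uq.antipode y) n j := by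
      change (starRingEnd ℂ) (β.rep (star (Uq.antipode y)) j n) = _
      rw [rep_star β hV, Matrix.conjTranspose_apply]
      simp
    rw [LinearMap.comp_apply, TensorProduct.map_tmul, LinearMap.mul'_apply, h,
      Uq.sandwich_tmul, Matrix.mul_apply]
    have h' : (β.u i m).1.ofConv x = β.rep x i m := rfl
    rw [h']
    simp [Matrix.mul_apply, Matrix.single_apply, ite_and]

/-- Linearity in `c` is not bundled into `sandwich`, where `c` is a parameter, so it is checked on
pure tensors. -/
lemma sandwich_eq_sum (c : Matrix (Fin N) (Fin N) ℂ) (z : UqG b q ⊗[ℂ] UqG b q) :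
    Uq.sandwich β.rep c z = ∑ m, ∑ n, c m n • Uq.sandwich β.rep (Matrix.single m n 1) z := by
  induction z using TensorProduct.induction_on with
  | zero => simp
  | add x y hx hy => simp only [map_add, hx, hy, smul_add, Finset.sum_add_distrib]
  | tmul x y =>
    conv_lhs => rw [Uq.sandwich_tmul, Matrix.matrix_eq_sum_single c]
    simp only [Uq.sandwich_tmul, Finset.mul_sum, Finset.sum_mul]
    refine Finset.sum_congr rfl fun m _ => Finset.sum_congr rfl fun n _ => ?_
    rw [← smul_mul_assoc, ← mul_smul_comm, Matrix.smul_single, smul_eq_mul, mul_one]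

/-- `𝖰` evaluated on `X` is the adjoint action of `X` on `c`. -/
lemma map_eval_Q (hV : IsUnitary b q V) (c : Matrix (Fin N) (Fin N) ℂ) (X : UqG b q) :
    (β.Q c).map (Cq.eval X) = Uq.sandwich β.rep c (Uq.comul X) := by
  ext i j
  rw [sandwich_eq_sum, Matrix.map_apply, Q]
  simp only [Matrix.sum_apply, Matrix.smul_apply, map_sum, map_smul, eval_Nmat β hV]

end WeightBasis
end QFlag

/-! ### The adjoint action of the generators; diagonal operators. -/

namespace QFlag
open LieAlgebra LieAlgebra.IsKilling TensorProduct

lemma prod_zpow_eq_zpow_sum₀ {ι G : Type*} [CommGroupWithZero G] {x : G} (hx : x ≠ 0)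
    (s : Finset ι) (f : ι → ℤ) : ∏ i ∈ s, x ^ f i = x ^ ∑ i ∈ s, f i := by
  induction s using Finset.cons_induction with
  | empty => simp
  | cons i s hi ih => rw [Finset.prod_cons, Finset.sum_cons, zpow_add₀ hx, ih]

/-- Serves both commutations of $M$: with $c$, supported on pairs of equal weights, and with
$\pi(F_a)$, supported on pairs of weights differing by $\alpha_a$. -/
lemma diagonal_mul_comm_of_ne_zero {n R : Type*} [Fintype n] [DecidableEq n] [CommRing R]
    {d : n → R} {X : Matrix n n R} (h : ∀ l m, X l m ≠ 0 → d l = d m) :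
    Matrix.diagonal d * X = X * Matrix.diagonal d := by
  ext l m
  rw [Matrix.diagonal_mul, Matrix.mul_diagonal]
  by_cases hX : X l m = 0
  · simp [hX]
  · rw [h l m hX, mul_comm]

namespace Uq
variable {I : Type*} {D : CartanDatum I} {q : ℝˣ} {n : Type*} [Fintype n] [DecidableEq n]
  (π : Uq D q →ₐ[ℂ] Matrix n n ℂ) (c : Matrix n n ℂ)

lemma sandwich_comul_one : sandwich π c (comul 1) = c := by
  rw [map_one, Algebra.TensorProduct.one_def, sandwich_tmul]
  simp [antipode]

/-- Both terms of $\Delta(E_i)$ leave $K_i^{-1}$ on the right. Under the trace this factor joins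
$K_{2\rho}$ and produces the shift by $\alpha_a$ in the final exponent. -/
lemma sandwich_comul_E (i : I) : sandwich π c (comul (E D q i))
    = (π (E D q i) * c - c * π (E D q i)) * π (Kinv D q i) := by
  rw [comul, lift_E, map_add, sandwich_tmul, sandwich_tmul]
  simp [antipode, antipodeHom, sub_eq_add_neg, add_mul, mul_assoc]

/-- The term $K_i^{-1}\otimes F_i$ contributes $-K_i^{-1}cK_iF_i$, which is $-cF_i$ exactly because
$c$ commutes with $K_i$. -/
lemma sandwich_comul_F (i : I) (hc : π (K D q i) * c = c * π (K D q i)) :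
    sandwich π c (comul (F D q i)) = π (F D q i) * c - c * π (F D q i) := by
  have h : π (Kinv D q i) * (c * (π (K D q i) * π (F D q i))) = c * π (F D q i) := by
    rw [← mul_assoc c, ← hc, mul_assoc, ← mul_assoc, ← map_mul, relations.k'_k, map_one, one_mul]
  rw [comul, lift_F, map_add, sandwich_tmul, sandwich_tmul]
  simp [antipode, antipodeHom, sub_eq_add_neg, mul_assoc, h]

lemma map_Kinv_of_diagonal {κ : n → ℂ} (hκ : ∀ l, κ l ≠ 0) (i : I)
    (h : π (K D q i) = Matrix.diagonal κ) :
    π (Kinv D q i) = Matrix.diagonal fun l => (κ l)⁻¹ := by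
  have h1 : π (Kinv D q i) * Matrix.diagonal κ = 1 := by
    rw [← h, ← map_mul, relations.k'_k, map_one]
  have h2 : Matrix.diagonal κ * Matrix.diagonal (fun l => (κ l)⁻¹) = 1 := by
    simp [Matrix.diagonal_mul_diagonal, hκ]
  exact left_inv_eq_right_inv h1 h2

/-- The monomial is a noncommutative product of units. Its image lies in the image of the
commutative group `n → ℂˣ` under the diagonal embedding `δ`, where the product is an ordinary one
and can be computed pointwise. -/
lemma map_Kmonomial_of_diagonal [Fintype I] {κ : n → I → ℂˣ}
    (h : ∀ i, π (K D q i) = Matrix.diagonal fun l => (κ l i : ℂ)) (p : I → ℤ) :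
    π (Kmonomial D q p) = Matrix.diagonal fun l => ((∏ i, κ l i ^ p i : ℂˣ) : ℂ) := by
  let δ : (n → ℂˣ) →* (Matrix n n ℂ)ˣ :=
    (Units.map (Matrix.diagonalRingHom n ℂ).toMonoidHom).comp
      (MulEquiv.piUnits (M := fun _ : n => ℂ)).symm.toMonoidHom
  have hδ (f : n → ℂˣ) : (δ f : Matrix n n ℂ) = Matrix.diagonal fun l => (f l : ℂ) := rfl
  have hK (i : I) : Units.map (π : Uq D q →* Matrix n n ℂ) (Kunit i) = δ fun l => κ l i :=
    Units.ext (h i)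
  have h1 : ∀ i, Units.map (π : Uq D q →* Matrix n n ℂ) (Kunit i ^ p i)
      = δ (fun l => κ l i ^ p i) := by
    intro i
    rw [map_zpow, hK, ← map_zpow]
    rfl
  have h2 (comm) : Finset.univ.noncommProd
      (fun i => Units.map (π : Uq D q →* Matrix n n ℂ) (Kunit i ^ p i)) comm
      = δ (∏ i, fun l => κ l i ^ p i) := by
    rw [Finset.noncommProd_congr rfl (fun i _ => h1 i), ← Finset.map_noncommProd _ _
      (fun _ _ _ _ _ => Commute.all _ _), Finset.noncommProd_eq_prod]
  refine (congr_arg Units.val ((Finset.map_noncommProd _ _ _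
    (Units.map (π : Uq D q →* Matrix n n ℂ))).trans (h2 _))).trans ?_
  rw [hδ]
  simp

end Uq

/-! ### Root lengths are nonzero; $2\rho$ in terms of the Cartan matrix. -/

variable {𝔤 : Type*} [LieRing 𝔤] [LieAlgebra ℂ 𝔤] [FiniteDimensional ℂ 𝔤] [IsSimple ℂ 𝔤]
variable {H : LieSubalgebra ℂ 𝔤} [H.IsCartanSubalgebra] (b : (rootSystem H).Base) (q : ℝˣ)

/-- There are finitely many roots, so the infimum `shortSq` is attained and positive; the
normalizing factor is therefore not a division by zero. -/
lemma form_root_ne_zero (α : H.root) :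
    form H ((rootSystem H).root α) ((rootSystem H).root α) ≠ 0 := by
  have : Nonempty H.root := ⟨α⟩
  obtain ⟨β, hβ⟩ := exists_eq_ciInf_of_finite
    (f := fun α : H.root => (killingDual H ((rootSystem H).root α) ((rootSystem H).root α)).re)
  obtain ⟨t, ht, hB⟩ := killingDual_root_pos β
  have hs : shortSq H = t := by rw [shortSq, ← hβ, hB, Complex.ofReal_re]
  rw [form, LinearMap.smul_apply, LinearMap.smul_apply, smul_eq_mul, hs]
  exact mul_ne_zero (by exact_mod_cast (by positivity : 2 / t ≠ 0)) (killingDual_root_ne_zero α)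

/-- `rootD` is chosen as some natural number with $(\alpha_i,\alpha_i)=2d_i$, which does not by
itself exclude zero. Needed to cancel $d_a^{-1}$ in the quantum number. -/
lemma rootD_ne_zero (i : b.support) : rootD b i ≠ 0 := by
  intro h
  have := form_root_self b i
  rw [h, Nat.cast_zero, mul_zero] at this
  exact form_root_ne_zero _ this

/-- `(2ρ, α_a^∨) = 2` in terms of the Cartan matrix. -/
lemma sum_mul_lieDatum_eq_two {p : b.support → ℤ}
    (hp : (2 : ℂ) • rho b = ∑ i, (p i : ℂ) • (rootSystem H).root i) (a : b.support) :
    ∑ j, (lieDatum b).a a j * p j = 2 := by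
  have h := two_rho_coroot b a
  rw [hp, LinearMap.sum_apply] at h
  have h1 (j : b.support) : (rootSystem H).root j ((rootSystem H).coroot a)
      = ((lieDatum b).a a j : ℂ) := (b.algebraMap_cartanMatrixIn_apply ℤ j a).symm
  simp only [LinearMap.smul_apply, h1, smul_eq_mul] at h
  have : ∑ j, (p j : ℂ) * ((lieDatum b).a a j : ℂ) = ∑ j, ((lieDatum b).a a j : ℂ) * p j :=
    Finset.sum_congr rfl fun _ _ => mul_comm _ _
  rw [this] at h
  exact_mod_cast h

end QFlag

/-! ### Weight bases: eigenvalues of the $K_j$ and commutation with $F_a$. -/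

namespace QFlag
open LieAlgebra LieAlgebra.IsKilling TensorProduct

variable {𝔤 : Type*} [LieRing 𝔤] [LieAlgebra ℂ 𝔤] [FiniteDimensional ℂ 𝔤] [IsSimple ℂ 𝔤]
variable {H : LieSubalgebra ℂ 𝔤} [H.IsCartanSubalgebra] {b : (rootSystem H).Base} {q : ℝˣ}

namespace WeightBasis
variable {V : Type*} [NormedAddCommGroup V] [InnerProductSpace ℂ V] [Module (UqG b q) V]
  {N : ℕ} (β : WeightBasis b q V N)

/-- The integer `λ_i(α_j^∨)`. -/
noncomputable def coord (i : Fin N) (j : b.support) : ℤ := (β.integral i j).choose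

lemma wt_coroot (i : Fin N) (j : b.support) :
    β.wt i ((rootSystem H).coroot j) = β.coord i j := (β.integral i j).choose_spec

/-- Integrality of the exponent replaces complex powers of $q$ by integer powers, so no branch of
the logarithm matters, even for $q<0$. -/
lemma form_wt (j : b.support) (i : Fin N) :
    form H ((rootSystem H).root j) (β.wt i) = ((rootD b j * β.coord i j : ℤ) : ℂ) := by
  rw [form_simpleRoot, wt_coroot]
  push_cast
  rfl

/-- The eigenvalue `q ^ (α_j, λ_i)` of `K_j` on `v_i`. -/
noncomputable def eigK (i : Fin N) (j : b.support) : ℂˣ :=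
  Units.map Complex.ofRealHom.toMonoidHom q ^ (rootD b j * β.coord i j : ℤ)

lemma eigK_val (i : Fin N) (j : b.support) :
    (β.eigK i j : ℂ) = ((q : ℝ) : ℂ) ^ (rootD b j * β.coord i j : ℤ) := by
  rw [eigK, Units.val_zpow_eq_zpow_val]
  rfl

lemma eigK_eq_qi (i : Fin N) (j : b.support) :
    (β.eigK i j : ℂ) = (lieDatum b).qi q j ^ β.coord i j := by
  rw [eigK_val, zpow_mul, zpow_natCast]
  rfl

/-- The left side is the eigenvalue of $K_{2\rho}K_a^{-1}$ on $v_l$; expanding $2\rho$ in simple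
roots collects it into one power of $q$. -/
lemma prod_eigK {p : b.support → ℤ}
    (hp : (2 : ℂ) • rho b = ∑ i, (p i : ℂ) • (rootSystem H).root i)
    (l : Fin N) (a : b.support) :
    (∏ j, (β.eigK l j : ℂ) ^ p j) * (β.eigK l a : ℂ)⁻¹ = ((q : ℝ) : ℂ) ^
      (-(form H ((rootSystem H).root a - (2 : ℂ) • rho b) (β.wt l))) := by
  have hq : ((q : ℝ) : ℂ) ≠ 0 := by simp
  have h1 : -(form H ((rootSystem H).root a - (2 : ℂ) • rho b) (β.wt l))
      = ((∑ j, (rootD b j * β.coord l j) * p j + -(rootD b a * β.coord l a) : ℤ) : ℂ) := by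
    rw [hp, map_sub, map_sum, LinearMap.sub_apply, LinearMap.sum_apply, form_wt]
    simp only [map_smul, LinearMap.smul_apply, form_wt, smul_eq_mul]
    push_cast
    rw [neg_sub, sub_eq_add_neg]
    simp only [mul_comm (p _ : ℂ)]
  rw [h1, Complex.cpow_intCast, zpow_add₀ hq, zpow_neg, ← eigK_val,
    ← prod_zpow_eq_zpow_sum₀ hq]
  simp only [zpow_mul _ (_ * _), ← eigK_val]

/-- The eigenvalues of the $K_j$ depend on the weight alone, and $c$ links only equal weights. The
arbitrary `f` covers both $K_a$ and $K_{2\rho}K_a^{-1}$. -/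
lemma diagonal_eigK_comm {c : Matrix (Fin N) (Fin N) ℂ} (hc : ∀ m n, β.wt m ≠ β.wt n → c m n = 0)
    (f : (b.support → ℂˣ) → ℂ) : Matrix.diagonal (fun l => f (β.eigK l)) * c
      = c * Matrix.diagonal fun l => f (β.eigK l) := by
  refine diagonal_mul_comm_of_ne_zero fun l m h => ?_
  have h1 : β.wt l = β.wt m := by
    by_contra h2
    exact h (hc _ _ h2)
  have h2 : β.coord l = β.coord m := by
    funext j
    have := β.wt_coroot l j
    rw [h1, wt_coroot] at this
    exact_mod_cast this.symm
  have h3 : β.eigK l = β.eigK m := by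
    funext j
    rw [eigK, eigK, h2]
  rw [h3]

/-- Since $d_a^{-1}(\alpha_a,\lambda_l)=\lambda_l(\alpha_a^\vee)$ is an integer, $q_a$ to this power
is the eigenvalue of $K_a$. The quantum number is thus the eigenvalue of $[E_a,F_a]$. -/
lemma qNumber_wt (a : b.support) (l : Fin N) :
    qNumber ((lieDatum b).qi q a) (((rootD b a : ℕ) : ℂ)⁻¹
        * form H ((rootSystem H).root a) (β.wt l))
      = ((lieDatum b).qi q a - ((lieDatum b).qi q a)⁻¹)⁻¹
        * ((β.eigK l a : ℂ) - (β.eigK l a : ℂ)⁻¹) := by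
  have h : ((rootD b a : ℕ) : ℂ) ≠ 0 := by exact_mod_cast rootD_ne_zero b a
  rw [form_simpleRoot, wt_coroot, inv_mul_cancel_left₀ h, qNumber, Complex.cpow_neg,
    Complex.cpow_intCast, ← eigK_eq_qi, div_eq_inv_mul]

variable [IsScalarTower ℂ (UqG b q) V]

lemma rep_K (j : b.support) : β.rep (Uq.K (lieDatum b) q j)
    = Matrix.diagonal fun i => (β.eigK i j : ℂ) := by
  ext k l
  rw [rep_apply, β.K_smul, form_wt, map_smul, Complex.cpow_intCast, ← eigK_val]
  by_cases hkl : k = l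
  · subst hkl; simp
  · simp [hkl]

lemma rep_Kinv (j : b.support) : β.rep (Uq.Kinv (lieDatum b) q j)
    = Matrix.diagonal fun i => (β.eigK i j : ℂ)⁻¹ :=
  Uq.map_Kinv_of_diagonal _ (fun _ => Units.ne_zero _) _ (β.rep_K j)

/-- $F_a$ lowers weights by $\alpha_a$. This is read off from the $(l,m)$ entry of
$F_aK_j=q^{(\alpha_j,\alpha_a)}K_jF_a$, with no need to compare the weights themselves. -/
lemma eigK_eq_of_rep_F_ne_zero {a : b.support} {l m : Fin N}
    (h : β.rep (Uq.F (lieDatum b) q a) l m ≠ 0) (j : b.support) :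
    (β.eigK m j : ℂ) = Uq.Q (lieDatum b) q j a * β.eigK l j := by
  have h1 := congr_arg β.rep (Uq.relations.fk (D := lieDatum b) (q := q) j a)
  rw [map_mul, map_smul, map_mul, rep_K] at h1
  have h2 := congr_fun₂ h1 l m
  rw [Matrix.mul_diagonal, Matrix.smul_apply, Matrix.diagonal_mul, smul_eq_mul] at h2
  exact mul_right_cancel₀ h (by rw [mul_comm, h2]; ring)

/-- `K_{2ρ}` acts diagonally, through the coefficients of `2ρ` in the simple roots. -/
lemma exists_rep_Klam_two_rho : ∃ p : b.support → ℤ,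
    (2 : ℂ) • rho b = ∑ i, (p i : ℂ) • (rootSystem H).root i ∧
    β.rep (Klam b q ((2 : ℂ) • rho b))
      = Matrix.diagonal fun l => ((∏ j, β.eigK l j ^ p j : ℂˣ) : ℂ) := by
  have h := exists_two_rho_eq b
  -- Taking the very coefficients chosen inside `Klam` avoids any appeal to their uniqueness.
  refine ⟨h.choose, h.choose_spec, ?_⟩
  rw [Klam, dif_pos h, Uq.map_Kmonomial_of_diagonal _ β.rep_K]

/-- Between weights joined by $F_a$, the eigenvalue of $K_{2\rho}$ changes by
$q^{(2\rho,\alpha_a)}=q_a^2$ and that of $K_a$ by $q^{(\alpha_a,\alpha_a)}=q_a^2$. The quotient is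
unchanged, so $K_{2\rho}K_a^{-1}$ commutes with $F_a$. -/
lemma prod_eigK_mul_of_rep_F_ne_zero {p : b.support → ℤ}
    (hp : (2 : ℂ) • rho b = ∑ i, (p i : ℂ) • (rootSystem H).root i)
    {a : b.support} {l m : Fin N}
    (h : β.rep (Uq.F (lieDatum b) q a) l m ≠ 0) :
    (∏ j, (β.eigK l j : ℂ) ^ p j) * (β.eigK l a : ℂ)⁻¹
      = (∏ j, (β.eigK m j : ℂ) ^ p j) * (β.eigK m a : ℂ)⁻¹ := by
  have h1 := β.eigK_eq_of_rep_F_ne_zero h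
  have h2 : ∏ j, Uq.Q (lieDatum b) q j a ^ p j = (lieDatum b).qi q a ^ 2 := by
    have h3 (j : b.support) : Uq.Q (lieDatum b) q j a ^ p j
        = (lieDatum b).qi q a ^ ((lieDatum b).a a j * p j) := by
      rw [Uq.Q_symm, Uq.Q, zpow_mul]
    simp only [h3]
    rw [prod_zpow_eq_zpow_sum₀ (Uq.qi_ne_zero _ _ _), sum_mul_lieDatum_eq_two b hp]
    norm_cast
  have h4 : (lieDatum b).qi q a ≠ 0 := Uq.qi_ne_zero _ _ _
  have h5 := (β.eigK l a).ne_zero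
  simp only [h1, mul_zpow, Finset.prod_mul_distrib, h2, Uq.Q_self]
  field_simp

lemma rep_E_F_commutator (a : b.support) :
    β.rep (Uq.E (lieDatum b) q a) * β.rep (Uq.F (lieDatum b) q a)
        - β.rep (Uq.F (lieDatum b) q a) * β.rep (Uq.E (lieDatum b) q a)
      = Matrix.diagonal fun l => ((lieDatum b).qi q a - ((lieDatum b).qi q a)⁻¹)⁻¹
        * ((β.eigK l a : ℂ) - (β.eigK l a : ℂ)⁻¹) := by
  rw [← map_mul, ← map_mul, ← map_sub, Uq.relations.e_f_same, map_smul, map_sub, rep_K,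
    rep_Kinv, Matrix.diagonal_sub, ← Matrix.diagonal_smul]
  rfl

/-! ### The pairing as a trace, and its evaluation. -/

lemma map_counit_Q (hV : IsUnitary b q V) (c : Matrix (Fin N) (Fin N) ℂ) :
    (β.Q c).map (Cq.counit (lieDatum b) q) = c :=
  (β.map_eval_Q hV c 1).trans (Uq.sandwich_comul_one _ _)

/-- The counit is multiplicative, so applied entrywise it respects matrix products and sends
$\mathsf Q$ to $c$. -/
lemma idempotent_of_idempotent_Q (hV : IsUnitary b q V) (c : Matrix (Fin N) (Fin N) ℂ)
    (hQ : IsIdempotentElem (β.Q c)) : c * c = c := by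
  have h : (β.Q c * β.Q c).map (Cq.counit (lieDatum b) q)
      = (β.Q c).map (Cq.counit (lieDatum b) q) * (β.Q c).map (Cq.counit (lieDatum b) q) := by
    ext i j
    simp only [Matrix.map_apply, Matrix.mul_apply, map_sum, Cq.counit_mul]
  rw [hQ.eq, β.map_counit_Q hV] at h
  exact h.symm

lemma eta_CQ_eq_trace (hV : IsUnitary b q V) (c : Matrix (Fin N) (Fin N) ℂ) (a : b.support)
    (hK : β.rep (Uq.K (lieDatum b) q a) * c = c * β.rep (Uq.K (lieDatum b) q a)) :
    eta (lieDatum b) q a (β.CQ c)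
      = (β.rep (Uq.Kinv (lieDatum b) q a) * β.rep (Klam b q ((2 : ℂ) • rho b)) * (2 • c - 1)
        * (β.rep (Uq.F (lieDatum b) q a) * c - c * β.rep (Uq.F (lieDatum b) q a))
        * (β.rep (Uq.E (lieDatum b) q a) * c - c * β.rep (Uq.E (lieDatum b) q a))).trace := by
  have h := etaXY_hochschildChain (Uq.F (lieDatum b) q a) (Uq.E (lieDatum b) q a)
    (β.rep (Klam b q ((2 : ℂ) • rho b))) (β.Q c)
    (β.map_counit_Q hV c) (β.map_eval_Q hV c _) (β.map_eval_Q hV c _)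
  refine h.trans ?_
  -- The factor $K_a^{-1}$ ending the value at $E_a$ is carried round the trace to the front.
  rw [Uq.sandwich_comul_E, Uq.sandwich_comul_F _ _ _ hK, ← mul_assoc, Matrix.trace_mul_comm]
  simp only [mul_assoc]

/-- The pairing `η_a(C(𝖰))` as a sum over the weight basis. -/
theorem eta_CQ (hV : IsUnitary b q V) (c : Matrix (Fin N) (Fin N) ℂ)
    (hQ : IsIdempotentElem (β.Q c)) (hc : ∀ m n, β.wt m ≠ β.wt n → c m n = 0) (a : b.support) :
    eta (lieDatum b) q a (β.CQ c) =
      ∑ i, c i i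
        * ((q : ℝ) : ℂ) ^ (-(form H ((rootSystem H).root a - (2 : ℂ) • rho b) (β.wt i)))
        * qNumber ((lieDatum b).qi q a) (((rootD b a : ℕ) : ℂ)⁻¹
              * form H ((rootSystem H).root a) (β.wt i)) := by
  have hρ := β.exists_rep_Klam_two_rho
  obtain ⟨p, hp, hT⟩ := hρ
  have hK : β.rep (Uq.K (lieDatum b) q a) * c = c * β.rep (Uq.K (lieDatum b) q a) := by
    rw [rep_K]
    exact β.diagonal_eigK_comm hc fun x => (x a : ℂ)
  have hM : β.rep (Uq.Kinv (lieDatum b) q a) * β.rep (Klam b q ((2 : ℂ) • rho b))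
      = Matrix.diagonal fun l => (∏ j, (β.eigK l j : ℂ) ^ p j) * (β.eigK l a : ℂ)⁻¹ := by
    rw [hT, rep_Kinv, Matrix.diagonal_mul_diagonal]
    simp [mul_comm]
  -- With $X=F_a$ and $Y=E_a$, the operator required to commute with $M$ is $F_a$, and $YX-XY$ is
  -- the commutator $[E_a,F_a]$ with its defining sign.
  have key := trace_idempotent_commutator c _ (β.rep (Uq.F (lieDatum b) q a))
    (β.rep (Uq.E (lieDatum b) q a)) (β.idempotent_of_idempotent_Q hV c hQ)
    (β.diagonal_eigK_comm hc fun x => (∏ j, (x j : ℂ) ^ p j) * (x a : ℂ)⁻¹)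
    (diagonal_mul_comm_of_ne_zero fun l m h => β.prod_eigK_mul_of_rep_F_ne_zero hp h)
  rw [β.rep_E_F_commutator, mul_assoc c, Matrix.diagonal_mul_diagonal, ← hM] at key
  refine ((β.eta_CQ_eq_trace hV c a hK).trans key).trans (Finset.sum_congr rfl fun l _ => ?_)
  rw [Matrix.diag_apply, Matrix.mul_diagonal, β.prod_eigK hp, qNumber_wt, mul_assoc]

end WeightBasis
end QFlag

theorem mainTheorem5
    {𝔤 : Type*} [LieRing 𝔤] [LieAlgebra ℂ 𝔤] [FiniteDimensional ℂ 𝔤] [LieAlgebra.IsSimple ℂ 𝔤]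
    {H : LieSubalgebra ℂ 𝔤} [H.IsCartanSubalgebra] (b : (LieAlgebra.IsKilling.rootSystem H).Base)
    (q : ℝˣ) (hq : |(q : ℝ)| ≠ 1)
    (V : Type*) [NormedAddCommGroup V] [InnerProductSpace ℂ V] [Module (QFlag.UqG b q) V]
    [IsScalarTower ℂ (QFlag.UqG b q) V] [IsSimpleModule (QFlag.UqG b q) V]
    (Λ : Module.Dual ℂ H) (hΛ : QFlag.HasHighestWeight b q V Λ) (hV : QFlag.IsUnitary b q V)
    (N : ℕ) (β : QFlag.WeightBasis b q V N) (c : Matrix (Fin N) (Fin N) ℂ)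
    (hQ : IsIdempotentElem (β.Q c)) (hc : ∀ m n, β.wt m ≠ β.wt n → c m n = 0)
    (a : b.support) :
    QFlag.eta (QFlag.lieDatum b) q a (β.CQ c) =
      ∑ i, c i i
        * ((q : ℝ) : ℂ) ^ (-(QFlag.form H
            ((LieAlgebra.IsKilling.rootSystem H).root a - (2 : ℂ) • QFlag.rho b) (β.wt i)))
        * QFlag.qNumber ((QFlag.lieDatum b).qi q a)
            (((QFlag.rootD b a : ℕ) : ℂ)⁻¹
              * QFlag.form H ((LieAlgebra.IsKilling.rootSystem H).root a) (β.wt i)) :=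
  β.eta_CQ hV c hQ hc a
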